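/- Let $N>2$ be an integer, $\beta>0$ and $m>0$. Let $\omega_N$ be the volume of the unit ball of $\mathbb R^N$ and let $M\ge\frac{m+2\beta}{\omega_N}$. Put $K(x)=\frac12|x|^2-\frac1{2-N}|x|^{2-N}$, $F(x)=\beta|x|^2$, $W(x)=\max\{F(x),(1+|x|)^2\}$, and $$E[\rho]=\frac12\int_{\mathbb R^N}\int_{\mathbb R^N}K(x-y)\rho(x)\rho(y)\,dx\,dy+\int_{\mathbb R^N}F(x)\rho(x)\,dx,$$ $$\mathcal D_{M,m}=\Big\{\rho\in L^1(\mathbb R^N)\cap L^\infty(\mathbb R^N):\ \rho\ge0,\ \|\rho\|_{L^\infty}\le M,\ \|\rho\|_{L^1}=m,\ \rho\in L^1(\mathbb R^N,W\,dx)\Big\}.$$ Then the integrals defining $E[\rho]$ converge absolutely for every $\rho\in\mathcal D_{M,m}$, and the function $$\rho_0=\frac{m+2\beta}{\omega_N}\,\chi_{B(0,r_0)},\qquad r_0=\Big(\frac{m}{m+2\beta}\Big)^{1/N},$$ where $\chi$ denotes the characteristic function of a set, is the global minimizer of $E$ in $\mathcal D_{M,m}$: it belongs to $\mathcal D_{M,m}$,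 $E[\rho_0]\le E[\rho]$ for every $\rho\in\mathcal D_{M,m}$, and every minimizer of $E$ in $\mathcal D_{M,m}$ equals $\rho_0$ almost everywhere. -/

import Mathlib

open MeasureTheory
open scoped ENNReal

noncomputable section

namespace ExogenousEnergy

/-- The space `ℝ^N` with its Euclidean norm and Lebesgue measure. -/
abbrev Space (N : ℕ) : Type := EuclideanSpace ℝ (Fin N)

/-- The volume `ω_N` of the unit ball of `ℝ^N`. -/
def unitBallVolume (N : ℕ) : ℝ := (volume : Measure (Space N)).real (Metric.ball 0 1)

/-- The power-law endogenous potential `K(x) = |x|^q / q - |x|^p / p`.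
For negative `p` it is singular at the origin, where its value is irrelevant:
it only enters through integrals over `x` and `y` of `K(x - y)`. -/
def kernel (N : ℕ) (q p : ℝ) (x : Space N) : ℝ := 1 / q * ‖x‖ ^ q - 1 / p * ‖x‖ ^ p

/-- The exogenous potential `F(x) = β |x|^2`. -/
def quadraticPotential (N : ℕ) (β : ℝ) (x : Space N) : ℝ := β * ‖x‖ ^ 2

/-- The weight `W`: equal to `max {F(x), (1+|x|)^q}` if `q > 0`, and to `F(x)` otherwise. -/
def weight (N : ℕ) (q : ℝ) (F : Space N → ℝ) (x : Space N) : ℝ :=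
  if 0 < q then max (F x) ((1 + ‖x‖) ^ q) else F x

/-- The admissible class `D_{M,m}`: the nonnegative `ρ ∈ L^1 ∩ L^∞` with `‖ρ‖_∞ ≤ M`,
`‖ρ‖_1 = m` and `ρ ∈ L^1(W dx)`. Functions stand for their classes modulo null sets. -/
def admissible (N : ℕ) (q : ℝ) (F : Space N → ℝ) (M m : ℝ) : Set (Space N → ℝ) :=
  {ρ | MemLp ρ 1 volume ∧ MemLp ρ ∞ volume ∧ (∀ᵐ x ∂volume, 0 ≤ ρ x) ∧
    eLpNorm ρ ∞ volume ≤ ENNReal.ofReal M ∧ eLpNorm ρ 1 volume = ENNReal.ofReal m ∧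
    Integrable (fun x => weight N q F x * ρ x) volume}

/-- The energy `E[ρ] = (1/2) ∬ K(x-y) ρ(x) ρ(y) dx dy + ∫ F(x) ρ(x) dx`. -/
def energy (N : ℕ) (K F : Space N → ℝ) (ρ : Space N → ℝ) : ℝ :=
  1 / 2 * (∫ y, ∫ x, K (x - y) * ρ x * ρ y) + ∫ x, F x * ρ x

/-- The integrals in `energy N K F ρ` converge absolutely, so that `E[ρ]` is a genuine
finite number. -/
def EnergyFinite (N : ℕ) (K F : Space N → ℝ) (ρ : Space N → ℝ) : Prop :=
  Integrable (fun z : Space N × Space N => K (z.1 - z.2) * ρ z.1 * ρ z.2) (volume.prod volume) ∧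
    Integrable (fun x => F x * ρ x) volume

/-- The radius `r_0 = (m / (m + 2β))^{1/N}`. -/
def radius (N : ℕ) (β m : ℝ) : ℝ := (m / (m + 2 * β)) ^ (1 / (N : ℝ))

/-- The density `ρ_0 = (m + 2β) / ω_N` on the ball `B(0, r_0)`, and `0` outside. -/
def ballDensity (N : ℕ) (β m : ℝ) : Space N → ℝ :=
  (Metric.ball (0 : Space N) (radius N β m)).indicator
    (fun _ => (m + 2 * β) / unitBallVolume N)

end ExogenousEnergy

end

/-! For a density ρ of mass m, expanding |x-y|² turns the quadratic interaction into (m/2)∫|x|²ρ -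
(1/2)|∫xρ|². The barycentre term is concave, but translating ρ to its centre of mass c absorbs it:
E[ρ] = G[ρ(·+c)] + βm|c|², with G[f] = (m/2+β)∫|x|²f + (1/(2(N-2)))∬|x-y|^{2-N}f(x)f(y)
(`IsDensity.energy_eq_translate`). It remains to show that ρ₀, which is centred, is the only
minimizer of G among densities of mass m.

G is quadratic, so with σ = f - ρ₀ one has exactly G[f] - G[ρ₀] = ∫Φσ +
(1/(2(N-2)))∬|x-y|^{2-N}σ(x)σ(y), where Φ is the potential created by the confinement and ρ₀
(`confinedEnergy_sub`). The linear term is nonnegative because Φ is constant on the ball and at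
least that constant outside, while σ has zero integral and is nonnegative off the ball. The
quadratic term is nonnegative and vanishes only for σ = 0. The bound M matters only through
boundedness of densities and through ρ₀ being admissible.

Two facts are proved from scratch. The potential of a ball is computed inside by integrating along
chords, and outside by exchanging the roles of two balls. Strict positive definiteness of
|x-y|^{2-N} comes from writing it, up to a positive factor, as ∫₀^∞ r^{1-2N}|B(x,r)∩B(y,r)| dr, a
superposition of products of ball indicators; Lebesgue differentiation gives strictness. -/

namespace ExogenousEnergy

/-! ### Newtonian kernel and polar coordinates -/

/-- The (unnormalized) Newtonian kernel `|x|^{2-N}`. -/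
noncomputable def newton (N : ℕ) (x : Space N) : ℝ := ‖x‖ ^ (2 - (N : ℝ))

lemma newton_nonneg {N : ℕ} (x : Space N) : 0 ≤ newton N x := by
  unfold newton; positivity

lemma newton_neg {N : ℕ} (x : Space N) : newton N (-x) = newton N x := by
  simp [newton]

lemma newton_sub_comm {N : ℕ} (x y : Space N) : newton N (x - y) = newton N (y - x) := by
  simp [newton, norm_sub_rev]

@[fun_prop]
lemma measurable_newton {N : ℕ} : Measurable (newton N) := by
  unfold newton; fun_prop

/-- The polar Jacobian cancels the singularity and leaves a bare r, so every radial integral of the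
kernel is elementary. -/
lemma pow_mul_rpow_newton {N : ℕ} (hN : 2 < N) {r : ℝ} (hr : 0 < r) :
    r ^ (N - 1) * r ^ (2 - (N : ℝ)) = r := by
  rw [← Real.rpow_natCast, ← Real.rpow_add hr]
  have : ((N - 1 : ℕ) : ℝ) + (2 - N) = 1 := by
    rw [Nat.cast_sub (by omega)]; push_cast; ring
  rw [this, Real.rpow_one]

/-- Integration in polar coordinates. -/
lemma integral_polar {N : ℕ} (hN : 0 < N) {f : Space N → ℝ} (hf : Integrable f) :
    ∫ y, f y = ∫ ω : Metric.sphere (0 : Space N) 1, ∫ r in Set.Ioi (0 : ℝ),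
      r ^ (N - 1) * f (r • (ω : Space N)) ∂volume ∂(volume : Measure (Space N)).toSphere := by
  have hdim : Module.finrank ℝ (Space N) = N := by simp
  have : Nonempty (Fin N) := ⟨⟨0, hN⟩⟩
  have mp := (volume : Measure (Space N)).measurePreserving_homeomorphUnitSphereProd
  set g : Metric.sphere (0 : Space N) 1 × Set.Ioi (0 : ℝ) → ℝ :=
    fun p => f (p.2.1 • (p.1 : Space N)) with hg
  have hgc : ∀ x : ({0}ᶜ : Set (Space N)), g (homeomorphUnitSphereProd (Space N) x) = f x := by
    intro x
    have hx : ‖(x : Space N)‖ ≠ 0 := norm_ne_zero_iff.mpr x.2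
    simp [hg, smul_smul, hx]
  have h1 : ∫ y, f y = ∫ p, g p ∂((volume : Measure (Space N)).toSphere.prod
      (.volumeIoiPow (Module.finrank ℝ (Space N) - 1))) := by
    rw [← mp.integral_comp (Homeomorph.measurableEmbedding _)]
    simp_rw [hgc]
    rw [integral_subtype_comap (measurableSet_singleton _).compl f, restrict_compl_singleton]
  have h2 : Integrable g ((volume : Measure (Space N)).toSphere.prod
      (.volumeIoiPow (Module.finrank ℝ (Space N) - 1))) := by
    rw [← mp.integrable_comp_emb (Homeomorph.measurableEmbedding _)]
    have : (g ∘ homeomorphUnitSphereProd (Space N)) = f ∘ Subtype.val := funext hgc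
    rw [this, ← integrableOn_iff_comap_subtypeVal (measurableSet_singleton _).compl]
    exact hf.integrableOn
  rw [h1, integral_prod _ h2]
  refine integral_congr_ae (.of_forall fun ω => ?_)
  simp only [hg, Measure.volumeIoiPow, ENNReal.ofReal, hdim]
  rw [integral_withDensity_eq_integral_smul, integral_subtype_comap measurableSet_Ioi
      fun a ↦ Real.toNNReal (a ^ (N - 1)) • f (a • (ω : Space N))]
  · refine setIntegral_congr_fun measurableSet_Ioi fun x hx ↦ ?_
    simp only [NNReal.smul_def, Real.coe_toNNReal _ (pow_nonneg (le_of_lt hx) _), smul_eq_mul]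
  · exact (measurable_subtype_coe.pow_const _).real_toNNReal

/-! ### Rotation invariance and second moments of the ball and the sphere -/

lemma exists_linearIsometryEquiv_eq {N : ℕ} {x y : Space N} (h : ‖x‖ = ‖y‖) :
    ∃ T : Space N ≃ₗᵢ[ℝ] Space N, T x = y :=
  ⟨_, Submodule.reflection_sub h⟩

lemma integral_comp_linearIsometryEquiv {N : ℕ} (T : Space N ≃ₗᵢ[ℝ] Space N) (f : Space N → ℝ) :
    ∫ x, f (T x) = ∫ x, f x :=
  T.measurePreserving.integral_comp T.toHomeomorph.measurableEmbedding f

lemma integral_Ioi_pow_indicator {n : ℕ} {R : ℝ} (hR : 0 ≤ R) :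
    ∫ r in Set.Ioi (0 : ℝ), (Set.Iio R).indicator (fun r => r ^ n) r = R ^ (n + 1) / (n + 1) := by
  rw [setIntegral_indicator measurableSet_Iio, Set.Ioi_inter_Iio, ← integral_Ioc_eq_integral_Ioo,
    ← intervalIntegral.integral_of_le hR]
  simp

lemma integral_norm_sq_ball {N : ℕ} (hN : 0 < N) :
    ∫ y in Metric.ball (0 : Space N) 1, ‖y‖ ^ 2 = N * unitBallVolume N / (N + 2) := by
  have : Nonempty (Fin N) := ⟨⟨0, hN⟩⟩
  have h := integral_fun_norm_addHaar (volume : Measure (Space N))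
    (fun r => (Set.Iio (1 : ℝ)).indicator (fun r => r ^ 2) r)
  rw [← integral_indicator Metric.isOpen_ball.measurableSet]
  have e : ∀ y : Space N, (Metric.ball (0 : Space N) 1).indicator (fun y => ‖y‖ ^ 2) y
      = (Set.Iio (1 : ℝ)).indicator (fun r => r ^ 2) ‖y‖ := by
    intro y; simp [Set.indicator]
  simp_rw [e]
  rw [h]
  have e2 : ∀ r : ℝ, r ^ (N - 1) • (Set.Iio (1 : ℝ)).indicator (fun r => r ^ 2) r
      = (Set.Iio (1 : ℝ)).indicator (fun r => r ^ (N + 1)) r := by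
    intro r
    by_cases hr : r < 1
    · simp only [Set.indicator, Set.mem_Iio, hr, if_true, smul_eq_mul, ← pow_add]
      congr 1; omega
    · simp [Set.indicator, hr]
  simp only [finrank_euclideanSpace, Fintype.card_fin, e2]
  rw [integral_Ioi_pow_indicator zero_le_one]
  simp only [unitBallVolume, nsmul_eq_mul, smul_eq_mul, one_pow]
  push_cast
  field_simp
  ring

lemma integrableOn_ball_of_continuous {N : ℕ} {f : Space N → ℝ} (hf : Continuous f) (x : Space N)
    (R : ℝ) : IntegrableOn f (Metric.ball x R) :=
  (hf.continuousOn.integrableOn_compact (isCompact_closedBall x R)).mono_set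
    Metric.ball_subset_closedBall

/-- By rotation invariance every unit direction gives the same value; summing over an orthonormal
basis gives ∫|y|², so each direction contributes an Nth of it. -/
lemma integral_inner_sq_ball {N : ℕ} (hN : 0 < N) (x : Space N) :
    ∫ y in Metric.ball (0 : Space N) 1, (inner ℝ x y) ^ 2
      = ‖x‖ ^ 2 * unitBallVolume N / (N + 2) := by
  set b := EuclideanSpace.basisFun (Fin N) ℝ
  have key : ∀ i, ∫ y in Metric.ball (0 : Space N) 1, (inner ℝ x y) ^ 2
      = ‖x‖ ^ 2 * ∫ y in Metric.ball (0 : Space N) 1, (inner ℝ (b i) y) ^ 2 := by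
    intro i
    obtain ⟨T, hT⟩ := exists_linearIsometryEquiv_eq (x := ‖x‖ • b i) (y := x)
      (by simp [norm_smul])
    rw [← integral_indicator Metric.isOpen_ball.measurableSet,
      ← integral_indicator Metric.isOpen_ball.measurableSet,
      ← integral_comp_linearIsometryEquiv T, ← integral_const_mul]
    refine integral_congr_ae (.of_forall fun y => ?_)
    have : inner ℝ x (T y) = ‖x‖ * inner ℝ (b i) y := by
      conv_lhs => rw [← hT, T.inner_map_map, inner_smul_left]
      simp
    simp only [Set.indicator, Metric.mem_ball, dist_zero_right, T.norm_map, this]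
    split_ifs <;> ring
  have hsum : ∑ i, ∫ y in Metric.ball (0 : Space N) 1, (inner ℝ (b i) y) ^ 2
      = ∫ y in Metric.ball (0 : Space N) 1, ‖y‖ ^ 2 := by
    rw [← integral_finsetSum]
    · refine integral_congr_ae (.of_forall fun y => ?_)
      simpa using b.sum_sq_norm_inner_right y
    · intro i _
      exact integrableOn_ball_of_continuous (by fun_prop) _ _
  have hN' : (N : ℝ) ≠ 0 := by positivity
  have : (N : ℝ) * ∫ y in Metric.ball (0 : Space N) 1, (inner ℝ x y) ^ 2
      = ‖x‖ ^ 2 * (N * unitBallVolume N / (N + 2)) := by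
    rw [← integral_norm_sq_ball hN, ← hsum, Finset.mul_sum, ← Finset.sum_congr rfl (fun i _ => key i)]
    simp
  field_simp at this ⊢
  linarith

/-- The ball moment in polar coordinates is the sphere moment times ∫₀¹ r^{N+1} dr = 1/(N+2). -/
lemma integral_inner_sq_sphere {N : ℕ} (hN : 0 < N) (x : Space N) :
    ∫ ω : Metric.sphere (0 : Space N) 1, (inner ℝ x (ω : Space N)) ^ 2
      ∂(volume : Measure (Space N)).toSphere = ‖x‖ ^ 2 * unitBallVolume N := by
  have h := integral_inner_sq_ball hN x
  rw [← integral_indicator Metric.isOpen_ball.measurableSet, integral_polar hN] at h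
  · have e : ∀ ω : Metric.sphere (0 : Space N) 1, ∫ r in Set.Ioi (0 : ℝ), r ^ (N - 1) *
        (Metric.ball (0 : Space N) 1).indicator (fun y => (inner ℝ x y) ^ 2) (r • (ω : Space N))
        = (inner ℝ x (ω : Space N)) ^ 2 * (1 / (N + 2)) := by
      intro ω
      have := integral_Ioi_pow_indicator (n := N + 1) (R := 1) zero_le_one
      have h2 : (1 : ℝ) / (N + 2) = 1 ^ (N + 1 + 1) / ((N + 1 : ℕ) + 1) := by
        push_cast; rw [one_pow]; ring
      rw [h2, ← this, ← integral_const_mul]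
      refine setIntegral_congr_fun measurableSet_Ioi fun r hr => ?_
      have hr0 : (0 : ℝ) < r := hr
      have hω : ‖(ω : Space N)‖ = 1 := by simp
      simp only [Set.indicator, Metric.mem_ball, dist_zero_right, norm_smul, hω, mul_one,
        Real.norm_of_nonneg hr0.le, Set.mem_Iio, inner_smul_right]
      split_ifs
      · obtain ⟨k, rfl⟩ := Nat.exists_eq_succ_of_ne_zero hN.ne'
        simp only [Nat.succ_eq_add_one, Nat.add_sub_cancel]
        ring
      · simp
    simp_rw [e] at h
    rw [integral_mul_const] at h
    field_simp at h
    linarith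
  · exact (integrable_indicator_iff Metric.isOpen_ball.measurableSet).2
      (integrableOn_ball_of_continuous (by fun_prop) _ _)

/-! ### Potential of a ball at interior points -/

lemma integrableOn_newton_ball_zero {N : ℕ} (hN : 2 < N) (R : ℝ) :
    IntegrableOn (newton N) (Metric.ball 0 R) := by
  have : Nonempty (Fin N) := ⟨⟨0, by omega⟩⟩
  unfold newton
  rw [integrableOn_fun_norm_addHaar (volume : Measure (Space N)) (f := fun r => r ^ (2 - (N : ℝ)))]
  have : IntegrableOn (fun y : ℝ => y) (Set.Ioo 0 R) :=
    (continuous_id.continuousOn.integrableOn_compact (isCompact_Icc (a := 0) (b := R))).mono_set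
      Set.Ioo_subset_Icc_self
  refine this.congr_fun (fun r hr => ?_) measurableSet_Ioo
  simp only [finrank_euclideanSpace, Fintype.card_fin, smul_eq_mul]
  exact (pow_mul_rpow_newton hN hr.1).symm

lemma integrable_indicator_ball_sub_mul_newton {N : ℕ} (hN : 2 < N) (R : ℝ) (x : Space N) :
    Integrable (fun y => (Metric.ball (0 : Space N) R).indicator 1 (x - y) * newton N y) := by
  have h := (integrable_indicator_iff Metric.isOpen_ball.measurableSet).2
    (integrableOn_newton_ball_zero hN (R + ‖x‖))
  have hm : Measurable fun y => (Metric.ball (0 : Space N) R).indicator (1 : Space N → ℝ) (x - y) :=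
    (measurable_one.indicator Metric.isOpen_ball.measurableSet).comp (by fun_prop)
  refine h.mono' (hm.mul measurable_newton).aestronglyMeasurable (.of_forall fun y => ?_)
  by_cases hy : x - y ∈ Metric.ball (0 : Space N) R
  · have : y ∈ Metric.ball (0 : Space N) (R + ‖x‖) := by
      simp only [Metric.mem_ball, dist_zero_right] at hy ⊢
      have := norm_sub_norm_le y x
      rw [norm_sub_rev] at this
      linarith
    simp [hy, this, abs_of_nonneg (newton_nonneg y)]
  · simp only [Set.indicator_of_notMem hy, zero_mul, norm_zero]
    exact Set.indicator_nonneg (fun z _ => newton_nonneg z) y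

/-- The potential `∫_{B(0,R)} |x-y|^{2-N} dy` of a ball. -/
noncomputable def ballPotential (N : ℕ) (R : ℝ) (x : Space N) : ℝ :=
  ∫ y in Metric.ball (0 : Space N) R, newton N (x - y)

lemma ballPotential_eq_integral {N : ℕ} (R : ℝ) (x : Space N) :
    ballPotential N R x =
      ∫ y, (Metric.ball (0 : Space N) R).indicator 1 (x - y) * newton N y := by
  rw [ballPotential, ← integral_indicator Metric.isOpen_ball.measurableSet,
    ← integral_sub_left_eq_self _ volume x]
  refine integral_congr_ae (.of_forall fun y => ?_)
  by_cases hy : x - y ∈ Metric.ball (0 : Space N) R <;> simp [hy]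

/-- The length of the chord of `B(0,R)` from an interior point `x` in a direction `-ω`
with `⟪x, ω⟫ = s`. -/
lemma norm_sub_smul_lt_iff {N : ℕ} {R r : ℝ} {x ω : Space N} (hx : ‖x‖ < R) (hω : ‖ω‖ = 1)
    (hr : 0 < r) :
    ‖x - r • ω‖ < R ↔ r < inner ℝ x ω + √((inner ℝ x ω) ^ 2 + (R ^ 2 - ‖x‖ ^ 2)) := by
  have hR : 0 < R := (norm_nonneg x).trans_lt hx
  have hd : 0 < R ^ 2 - ‖x‖ ^ 2 := by nlinarith [norm_nonneg x]
  rw [← sq_lt_sq₀ (norm_nonneg _) hR.le, norm_sub_sq_real, inner_smul_right, norm_smul, hω,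
    Real.norm_of_nonneg hr.le]
  set s := inner ℝ x ω
  have hsq : √(s ^ 2 + (R ^ 2 - ‖x‖ ^ 2)) ^ 2 = s ^ 2 + (R ^ 2 - ‖x‖ ^ 2) :=
    Real.sq_sqrt (by positivity)
  set q := √(s ^ 2 + (R ^ 2 - ‖x‖ ^ 2))
  have hq : |s| < q := by
    rw [← sq_lt_sq₀ (abs_nonneg _) (Real.sqrt_nonneg _), sq_abs, hsq]; linarith
  obtain ⟨h1, h2⟩ := abs_lt.1 hq
  -- As a quadratic in r this has roots s + q and s - q; the second is negative since |s| < q, so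
  -- only s + q matters for r > 0.
  have : ‖x‖ ^ 2 - 2 * (r * s) + (r * 1) ^ 2 - R ^ 2 = (r - s - q) * (r - s + q) := by
    linear_combination hsq
  constructor
  · intro h
    by_contra! hc
    nlinarith [mul_nonneg (sub_nonneg.2 hc) (by linarith : 0 ≤ r - s + q)]
  · intro h
    nlinarith [mul_pos (sub_pos.2 h) (by linarith : 0 < r - s + q)]

/-- Along a ray the integrand is r up to the chord length L and 0 beyond it, whence L²/2. -/
lemma chord_integral {N : ℕ} (hN : 2 < N) {R : ℝ} {x ω : Space N} (hx : ‖x‖ < R) (hω : ‖ω‖ = 1) :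
    ∫ r in Set.Ioi (0 : ℝ), r ^ (N - 1) *
        ((Metric.ball (0 : Space N) R).indicator 1 (x - r • ω) * newton N (r • ω))
      = (inner ℝ x ω + √((inner ℝ x ω) ^ 2 + (R ^ 2 - ‖x‖ ^ 2))) ^ 2 / 2 := by
  have hR : 0 < R := (norm_nonneg x).trans_lt hx
  have hd : 0 < R ^ 2 - ‖x‖ ^ 2 := by nlinarith [norm_nonneg x]
  have hL : 0 ≤ inner ℝ x ω + √((inner ℝ x ω) ^ 2 + (R ^ 2 - ‖x‖ ^ 2)) := by
    have := Real.abs_le_sqrt (x := inner ℝ x ω) (y := (inner ℝ x ω) ^ 2 + (R ^ 2 - ‖x‖ ^ 2))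
      (by linarith)
    linarith [neg_abs_le (inner ℝ x ω)]
  have := integral_Ioi_pow_indicator (n := 1) hL
  norm_num at this
  rw [← this]
  refine setIntegral_congr_fun measurableSet_Ioi fun r hr => ?_
  have hr0 : (0 : ℝ) < r := hr
  have hn : newton N (r • ω) = r ^ (2 - (N : ℝ)) := by
    simp [newton, norm_smul, hω, abs_of_pos hr0]
  simp only [hn, Set.indicator, Metric.mem_ball, dist_zero_right, norm_sub_smul_lt_iff hx hω hr0,
    Set.mem_Iio, Pi.one_apply]
  split_ifs
  · rw [one_mul, pow_mul_rpow_newton hN hr0]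
  · simp

/-- Pairing each direction with its opposite removes the square roots: the chord lengths q + s and q
- s have half sum of squares s² + q² = 2s² + R² - |x|², whose integral over the sphere is known. -/
lemma ballPotential_of_norm_lt {N : ℕ} (hN : 2 < N) {R : ℝ} {x : Space N} (hx : ‖x‖ < R) :
    ballPotential N R x
      = unitBallVolume N * (N / 2 * R ^ 2 - (N - 2) / 2 * ‖x‖ ^ 2) := by
  have hN0 : 0 < N := by omega
  have hd : 0 < R ^ 2 - ‖x‖ ^ 2 := by nlinarith [norm_nonneg x]
  have key : 2 * ballPotential N R x =
      ∫ y, ((Metric.ball (0 : Space N) R).indicator 1 (x - y) * newton N y) +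
        ((Metric.ball (0 : Space N) R).indicator 1 (x - -y) * newton N (-y)) := by
    rw [integral_add (integrable_indicator_ball_sub_mul_newton hN R x)
      (integrable_indicator_ball_sub_mul_newton hN R x).comp_neg,
      integral_neg_eq_self (fun y => (Metric.ball (0 : Space N) R).indicator 1 (x - y) * newton N y),
      ballPotential_eq_integral]
    ring
  replace key := key.trans (integral_polar hN0
    ((integrable_indicator_ball_sub_mul_newton hN R x).add
      (integrable_indicator_ball_sub_mul_newton hN R x).comp_neg))
  have e : ∀ ω : Metric.sphere (0 : Space N) 1, ∫ r in Set.Ioi (0 : ℝ), r ^ (N - 1) *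
      ((Metric.ball (0 : Space N) R).indicator 1 (x - r • (ω : Space N)) * newton N (r • (ω : Space N))
      + (Metric.ball (0 : Space N) R).indicator 1 (x - -(r • (ω : Space N)))
          * newton N (-(r • (ω : Space N))))
      = 2 * (inner ℝ x (ω : Space N)) ^ 2 + (R ^ 2 - ‖x‖ ^ 2) := by
    intro ω
    have hω : ‖(ω : Space N)‖ = 1 := by simp
    have hω' : ‖-(ω : Space N)‖ = 1 := by simp
    have hi : ∀ ω : Space N, ‖ω‖ = 1 → IntegrableOn (fun r : ℝ => r ^ (N - 1) *
        ((Metric.ball (0 : Space N) R).indicator 1 (x - r • ω) * newton N (r • ω)))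
        (Set.Ioi 0) := by
      intro ω hω
      -- A non-integrable function has integral 0 by convention, so the positive value of the chord
      -- integral proves integrability.
      refine Integrable.of_integral_ne_zero ?_
      rw [chord_integral hN hx hω]
      have := Real.lt_sqrt_of_sq_lt (x := |inner ℝ x ω|)
        (y := (inner ℝ x ω) ^ 2 + (R ^ 2 - ‖x‖ ^ 2)) (by rw [sq_abs]; linarith)
      have : 0 < inner ℝ x ω + √((inner ℝ x ω) ^ 2 + (R ^ 2 - ‖x‖ ^ 2)) := by
        linarith [neg_abs_le (inner ℝ x ω)]
      positivity
    simp_rw [mul_add, ← smul_neg]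
    rw [integral_add (hi _ hω) (hi _ hω'), chord_integral hN hx hω, chord_integral hN hx hω']
    simp only [inner_neg_right, neg_sq]
    have hsq : √((inner ℝ x (ω : Space N)) ^ 2 + (R ^ 2 - ‖x‖ ^ 2)) ^ 2
      = (inner ℝ x (ω : Space N)) ^ 2 + (R ^ 2 - ‖x‖ ^ 2) := Real.sq_sqrt (by positivity)
    linear_combination hsq
  simp_rw [e] at key
  rw [integral_add, integral_const_mul, integral_inner_sq_sphere hN0, integral_const,
    Measure.toSphere_real_apply_univ] at key
  · simp only [finrank_euclideanSpace, Fintype.card_fin, smul_eq_mul] at key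
    rw [← unitBallVolume] at key
    linear_combination key / 2
  · refine Integrable.const_mul (Integrable.of_bound
      (C := ‖x‖ ^ 2) (by fun_prop) (.of_forall fun ω => ?_)) 2
    rw [Real.norm_of_nonneg (sq_nonneg _), ← sq_abs]
    gcongr
    simpa using abs_real_inner_le_norm x (ω : Space N)
  · exact integrable_const _

/-! ### Integrability and symmetry of Newtonian double integrals -/

lemma newton_le_one {N : ℕ} (hN : 2 < N) {x : Space N} (hx : 1 ≤ ‖x‖) : newton N x ≤ 1 := by
  have : (2 : ℝ) < N := by exact_mod_cast hN
  exact Real.rpow_le_one_of_one_le_of_nonpos hx (by linarith)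

/-- Split at distance 1. Nearby, f is bounded and the kernel is locally integrable; far away the
kernel is at most 1 and f ⊗ g is integrable. -/
lemma integrable_newton_sub_mul_mul {N : ℕ} (hN : 2 < N) {f g : Space N → ℝ} (hf : Integrable f)
    {C : ℝ} (hC : ∀ᵐ x, ‖f x‖ ≤ C) (hg : Integrable g) :
    Integrable (fun z : Space N × Space N => newton N (z.1 - z.2) * f z.1 * g z.2)
      (volume.prod volume) := by
  have h1 := (measurePreserving_sub_prod (volume : Measure (Space N)) volume).integrable_comp_of_integrable
    (((integrable_indicator_iff Metric.isOpen_ball.measurableSet).2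
    (integrableOn_newton_ball_zero hN 1)).mul_prod hg.norm)
  have h2 := hf.norm.mul_prod hg.norm
  refine ((h1.const_mul C).add h2).mono' ?_ ?_
  · exact ((measurable_newton.comp (by fun_prop)).aestronglyMeasurable.mul
      hf.aestronglyMeasurable.comp_fst).mul hg.aestronglyMeasurable.comp_snd
  · filter_upwards [Measure.quasiMeasurePreserving_fst.ae hC] with z hz
    simp only [Pi.add_apply, Function.comp_apply, norm_mul,
      Real.norm_of_nonneg (newton_nonneg _)]
    rw [← mul_assoc, ← add_mul]
    gcongr
    by_cases h : z.1 - z.2 ∈ Metric.ball (0 : Space N) 1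
    · rw [Set.indicator_of_mem h]
      nlinarith [newton_nonneg (z.1 - z.2), norm_nonneg (f z.1)]
    · rw [Set.indicator_of_notMem h]
      have := newton_le_one hN (x := z.1 - z.2) (by simpa using h)
      nlinarith [newton_nonneg (z.1 - z.2), norm_nonneg (f z.1)]

lemma integrable_indicator_ball {N : ℕ} (R c : ℝ) :
    Integrable ((Metric.ball (0 : Space N) R).indicator fun _ => c) :=
  (integrable_indicator_iff Metric.isOpen_ball.measurableSet).2
    (integrableOn_const measure_ball_lt_top.ne)

lemma norm_indicator_ball_le {N : ℕ} (R c : ℝ) (x : Space N) :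
    ‖(Metric.ball (0 : Space N) R).indicator (fun _ => c) x‖ ≤ |c| := by
  simpa using norm_indicator_le_norm_self (s := Metric.ball (0 : Space N) R) (fun _ => c) x

lemma ballPotential_eq_integral_mul {N : ℕ} (R : ℝ) (x : Space N) :
    ballPotential N R x =
      ∫ y, newton N (x - y) * (Metric.ball (0 : Space N) R).indicator (fun _ => 1) y := by
  rw [ballPotential, ← integral_indicator Metric.isOpen_ball.measurableSet]
  refine integral_congr_ae (.of_forall fun y => ?_)
  by_cases hy : y ∈ Metric.ball (0 : Space N) R <;> simp [hy]

lemma integrable_ballPotential_mul {N : ℕ} (hN : 2 < N) (R : ℝ) {f : Space N → ℝ}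
    (hf : Integrable f) {C : ℝ} (hC : ∀ᵐ x, ‖f x‖ ≤ C) :
    Integrable fun x => ballPotential N R x * f x := by
  have h := (integrable_newton_sub_mul_mul hN hf hC (integrable_indicator_ball R 1)).integral_prod_left
  refine h.congr (.of_forall fun x => ?_)
  simp only [ballPotential_eq_integral_mul, ← integral_mul_const]
  exact integral_congr_ae (.of_forall fun y => by ring)

lemma integral_ballPotential_mul {N : ℕ} (hN : 2 < N) (R : ℝ) {f : Space N → ℝ}
    (hf : Integrable f) {C : ℝ} (hC : ∀ᵐ x, ‖f x‖ ≤ C) :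
    ∫ x, ballPotential N R x * f x = ∫ z : Space N × Space N, newton N (z.1 - z.2) * f z.1 *
      (Metric.ball (0 : Space N) R).indicator (fun _ => 1) z.2 ∂(volume.prod volume) := by
  rw [integral_prod _ (integrable_newton_sub_mul_mul hN hf hC (integrable_indicator_ball R 1))]
  refine integral_congr_ae (.of_forall fun x => ?_)
  simp only [ballPotential_eq_integral_mul, ← integral_mul_const]
  exact integral_congr_ae (.of_forall fun y => by ring)

lemma setIntegral_ball_eq_integral_mul {N : ℕ} (R : ℝ) (f : Space N → ℝ) :
    ∫ x in Metric.ball (0 : Space N) R, f x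
      = ∫ x, f x * (Metric.ball (0 : Space N) R).indicator (fun _ => 1) x := by
  rw [← integral_indicator Metric.isOpen_ball.measurableSet]
  refine integral_congr_ae (.of_forall fun y => ?_)
  by_cases hy : y ∈ Metric.ball (0 : Space N) R <;> simp [hy]

lemma integrableOn_ballPotential {N : ℕ} (hN : 2 < N) (R S : ℝ) :
    IntegrableOn (ballPotential N R) (Metric.ball 0 S) := by
  rw [← integrable_indicator_iff Metric.isOpen_ball.measurableSet]
  refine (integrable_ballPotential_mul hN R (integrable_indicator_ball S 1)
    (.of_forall (norm_indicator_ball_le S 1))).congr (.of_forall fun y => ?_)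
  by_cases hy : y ∈ Metric.ball (0 : Space N) S <;> simp [hy]

/-- Symmetry of the kernel trades an integral reaching outside the source ball for one of an
interior potential, when S ≥ R. -/
lemma setIntegral_ballPotential_comm {N : ℕ} (hN : 2 < N) (R S : ℝ) :
    ∫ x in Metric.ball (0 : Space N) S, ballPotential N R x
      = ∫ x in Metric.ball (0 : Space N) R, ballPotential N S x := by
  rw [setIntegral_ball_eq_integral_mul, setIntegral_ball_eq_integral_mul,
    integral_ballPotential_mul hN R (integrable_indicator_ball S 1)
      (.of_forall (norm_indicator_ball_le S 1)),
    integral_ballPotential_mul hN S (integrable_indicator_ball R 1)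
      (.of_forall (norm_indicator_ball_le R 1)), ← integral_prod_swap]
  refine integral_congr_ae (.of_forall fun z => ?_)
  simp only [Prod.fst_swap, Prod.snd_swap, newton_sub_comm z.2 z.1]
  ring

/-! ### Potential of a ball at exterior points -/

lemma unitBallVolume_pos (N : ℕ) : 0 < unitBallVolume N :=
  ENNReal.toReal_pos (Metric.measure_ball_pos _ _ one_pos).ne' measure_ball_lt_top.ne

lemma volume_real_ball {N : ℕ} {R : ℝ} (hR : 0 < R) :
    (volume : Measure (Space N)).real (Metric.ball 0 R) = R ^ N * unitBallVolume N := by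
  simp [Measure.real, unitBallVolume, Measure.addHaar_ball_of_pos volume (0 : Space N) hR,
    ENNReal.toReal_mul, ENNReal.toReal_ofReal (pow_nonneg hR.le N)]

/-- After exchanging the balls, the integrand on B(0,R) is the potential of the shell between radii
a and b, which is constant in its cavity. -/
lemma setIntegral_ballPotential_annulus {N : ℕ} (hN : 2 < N) {R a b : ℝ} (hR : 0 < R)
    (ha : R ≤ a) (hab : a ≤ b) :
    ∫ x in Metric.ball (0 : Space N) b \ Metric.ball 0 a, ballPotential N R x
      = unitBallVolume N * (N / 2 * (b ^ 2 - a ^ 2)) * (R ^ N * unitBallVolume N) := by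
  rw [setIntegral_sdiff Metric.isOpen_ball.measurableSet (integrableOn_ballPotential hN R b)
    (Metric.ball_subset_ball hab), setIntegral_ballPotential_comm hN R b, setIntegral_ballPotential_comm hN R a,
    ← integral_sub (integrableOn_ballPotential hN b R) (integrableOn_ballPotential hN a R)]
  rw [setIntegral_congr_fun (g := fun _ => unitBallVolume N * (N / 2 * (b ^ 2 - a ^ 2)))
    Metric.isOpen_ball.measurableSet, setIntegral_const, volume_real_ball hR]
  · rw [smul_eq_mul]; ring
  · intro x hx
    rw [Metric.mem_ball, dist_zero_right] at hx
    simp only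
    rw [ballPotential_of_norm_lt hN (by linarith), ballPotential_of_norm_lt hN (by linarith)]
    ring

lemma setIntegral_newton_annulus {N : ℕ} (hN : 2 < N) {a b : ℝ} (ha : 0 < a) (hab : a ≤ b) :
    ∫ x in Metric.ball (0 : Space N) b \ Metric.ball 0 a, newton N x
      = unitBallVolume N * (N / 2 * (b ^ 2 - a ^ 2)) := by
  have h : ∀ c : ℝ, 0 < c → ∫ x in Metric.ball (0 : Space N) c, newton N x
      = unitBallVolume N * (N / 2 * c ^ 2) := by
    intro c hc
    have := ballPotential_of_norm_lt hN (R := c) (x := 0) (by simpa using hc)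
    simpa [ballPotential, newton_neg] using this
  rw [setIntegral_sdiff Metric.isOpen_ball.measurableSet (integrableOn_newton_ball_zero hN b)
    (Metric.ball_subset_ball hab), h a ha, h b (by linarith)]
  ring

lemma ballPotential_eq_of_norm_eq {N : ℕ} (R : ℝ) {x y : Space N} (h : ‖x‖ = ‖y‖) :
    ballPotential N R x = ballPotential N R y := by
  obtain ⟨T, rfl⟩ := exists_linearIsometryEquiv_eq h
  rw [ballPotential_eq_integral_mul, ballPotential_eq_integral_mul,
    ← integral_comp_linearIsometryEquiv T (fun z => newton N (T x - z) * _)]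
  refine integral_congr_ae (.of_forall fun z => ?_)
  simp [← map_sub, newton, T.norm_map, Set.indicator]

/-- Near x the distance to the ball stays at least δ, so the kernel is dominated by a constant.
Continuity lets annulus integrals determine pointwise values. -/
lemma continuousAt_ballPotential {N : ℕ} (hN : 2 < N) {R : ℝ} {x : Space N} (hx : R < ‖x‖) :
    ContinuousAt (ballPotential N R) x := by
  have hN' : (2 : ℝ) < N := by exact_mod_cast hN
  set δ := (‖x‖ - R) / 2 with hδ
  have hδ0 : 0 < δ := by rw [hδ]; linarith
  refine continuousAt_of_dominated (bound := fun _ => δ ^ (2 - (N : ℝ))) ?_ ?_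
    (integrableOn_const measure_ball_lt_top.ne) ?_
  · exact .of_forall fun y => (measurable_newton.comp (by fun_prop)).aestronglyMeasurable
  · filter_upwards [Metric.ball_mem_nhds x hδ0] with y hy
    filter_upwards [ae_restrict_mem Metric.isOpen_ball.measurableSet] with z hz
    rw [Real.norm_of_nonneg (newton_nonneg _)]
    refine Real.rpow_le_rpow_of_nonpos hδ0 ?_ (by linarith)
    rw [mem_ball_iff_norm] at hy
    rw [mem_ball_zero_iff] at hz
    have h1 := norm_sub_norm_le x y
    have h2 := norm_sub_norm_le y z
    rw [norm_sub_rev] at h1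
    linarith
  · filter_upwards [ae_restrict_mem Metric.isOpen_ball.measurableSet] with z hz
    rw [mem_ball_zero_iff] at hz
    have : x - z ≠ 0 := fun h => by rw [sub_eq_zero.1 h] at hx; linarith
    unfold newton
    exact ContinuousAt.rpow_const (by fun_prop) (.inl (norm_ne_zero_iff.2 this))

/-- A radial function whose integrals over annuli vanish is nonpositive at its points of continuity. -/
lemma radial_nonpos_of_setIntegral_annulus_eq_zero {N : ℕ} {g : Space N → ℝ}
    (hg : ∀ x y : Space N, ‖x‖ = ‖y‖ → g x = g y) {x₀ : Space N} (hx₀ : x₀ ≠ 0)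
    (hc : ContinuousAt g x₀)
    (hi : ∀ b, IntegrableOn g (Metric.ball (0 : Space N) b))
    (h0 : ∀ b, ‖x₀‖ ≤ b → ∫ x in Metric.ball (0 : Space N) b \ Metric.ball 0 ‖x₀‖, g x = 0) :
    g x₀ ≤ 0 := by
  by_contra! hpos
  obtain ⟨ε, hε, hball⟩ := Metric.eventually_nhds_iff.1 (hc.eventually (lt_mem_nhds hpos))
  have hs : 0 < ‖x₀‖ := norm_pos_iff.2 hx₀
  set A := Metric.ball (0 : Space N) (‖x₀‖ + ε) \ Metric.ball 0 ‖x₀‖ with hA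
  have hAm : MeasurableSet A :=
    Metric.isOpen_ball.measurableSet.diff Metric.isOpen_ball.measurableSet
  have hgA : ∀ x ∈ A, 0 < g x := by
    intro x hx
    simp only [hA, Set.mem_sdiff, mem_ball_zero_iff, not_lt] at hx
    -- Replace x by the point of the same norm on the ray through x₀; that point lies within ε of
    -- x₀.
    rw [hg x ((‖x‖ / ‖x₀‖) • x₀) (by rw [norm_smul]; simp [hs.ne'])]
    apply hball
    have : (‖x‖ / ‖x₀‖) • x₀ - x₀ = ((‖x‖ - ‖x₀‖) / ‖x₀‖) • x₀ := by
      rw [sub_div, div_self hs.ne', sub_smul, one_smul]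
    rw [dist_eq_norm, this, norm_smul, Real.norm_of_nonneg (div_nonneg (by linarith) hs.le),
      div_mul_cancel₀ _ hs.ne']
    linarith
  have hvol : 0 < volume A := by
    have hopen : IsOpen {x : Space N | ‖x₀‖ < ‖x‖ ∧ ‖x‖ < ‖x₀‖ + ε} :=
      (isOpen_lt continuous_const continuous_norm).inter
        (isOpen_lt continuous_norm continuous_const)
    refine (hopen.measure_pos volume ⟨((‖x₀‖ + ε / 2) / ‖x₀‖) • x₀, ?_⟩).trans_le
      (measure_mono fun x hx => ?_)
    · simp only [Set.mem_ofPred_eq, norm_smul]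
      rw [Real.norm_of_nonneg (by positivity), div_mul_cancel₀ _ hs.ne']
      constructor <;> linarith
    · simp only [hA, Set.mem_sdiff, mem_ball_zero_iff, not_lt]
      exact ⟨hx.2, hx.1.le⟩
  have := (setIntegral_pos_iff_support_of_nonneg_ae (μ := volume) (s := A) (f := g)
    ((ae_restrict_mem hAm).mono fun x hx => (hgA x hx).le)
    ((hi _).mono_set Set.sdiff_subset)).2 (by
      rwa [Set.inter_eq_right.2 fun x hx => Function.mem_support.2 (hgA x hx).ne'])
  rw [h0 _ (by linarith)] at this
  exact lt_irrefl _ this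

/-- **Newton's theorem**: outside a ball its potential is that of a point mass. -/
lemma ballPotential_of_lt_norm {N : ℕ} (hN : 2 < N) {R : ℝ} (hR : 0 < R) {x : Space N}
    (hx : R < ‖x‖) :
    ballPotential N R x = R ^ N * unitBallVolume N * newton N x := by
  have hx0 : x ≠ 0 := norm_pos_iff.1 (hR.trans hx)
  have hrad : ∀ y z : Space N, ‖y‖ = ‖z‖ →
      ballPotential N R y - R ^ N * unitBallVolume N * newton N y
        = ballPotential N R z - R ^ N * unitBallVolume N * newton N z := by
    intro y z h
    rw [ballPotential_eq_of_norm_eq R h, newton, newton, h]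
  have hc : ContinuousAt (fun y => ballPotential N R y - R ^ N * unitBallVolume N * newton N y) x := by
    refine (continuousAt_ballPotential hN hx).sub (continuousAt_const.mul ?_)
    unfold newton
    exact ContinuousAt.rpow_const (by fun_prop) (.inl (norm_ne_zero_iff.2 hx0))
  have hi : ∀ b, IntegrableOn (fun y => ballPotential N R y - R ^ N * unitBallVolume N * newton N y)
      (Metric.ball (0 : Space N) b) := fun b =>
    (integrableOn_ballPotential hN R b).sub ((integrableOn_newton_ball_zero hN b).const_mul _)
  have h0 : ∀ b, ‖x‖ ≤ b → ∫ y in Metric.ball (0 : Space N) b \ Metric.ball 0 ‖x‖,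
      (ballPotential N R y - R ^ N * unitBallVolume N * newton N y) = 0 := by
    intro b hb
    rw [integral_sub ((integrableOn_ballPotential hN R b).mono_set Set.sdiff_subset)
      (((integrableOn_newton_ball_zero hN b).mono_set Set.sdiff_subset).const_mul _),
      integral_const_mul, setIntegral_newton_annulus hN (hR.trans hx) hb,
      setIntegral_ballPotential_annulus hN hR hx.le hb]
    ring
  -- The difference and its negative satisfy the same hypotheses, so both are nonpositive at x.
  have h1 := radial_nonpos_of_setIntegral_annulus_eq_zero hrad hx0 hc hi h0
  have h2 := radial_nonpos_of_setIntegral_annulus_eq_zero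
    (fun y z h => congrArg Neg.neg (hrad y z h)) hx0 hc.neg (fun b => (hi b).neg)
    (fun b hb => (integral_neg _).trans (by rw [h0 b hb, neg_zero]))
  linarith

/-! ### Positive definiteness from a feature map -/

section FeatureMap

variable {X T : Type*} [MeasurableSpace X] [MeasurableSpace T] {μ : Measure X} {τ : Measure T}
  [SFinite μ] [SFinite τ]

/-- A quadratic form whose kernel is given by a nonnegative feature map is an integral of squares. -/
lemma integral_featureMap {h : X → T → ℝ} (hm : Measurable (Function.uncurry h))
    (h0 : ∀ x t, 0 ≤ h x t) {k : X → X → ℝ}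
    (hk : ∀ᵐ z ∂μ.prod μ, Integrable (fun t => h z.1 t * h z.2 t) τ ∧
      ∫ t, h z.1 t * h z.2 t ∂τ = k z.1 z.2)
    {σ : X → ℝ} (hσ : AEStronglyMeasurable σ μ)
    (hi : Integrable (fun z : X × X => k z.1 z.2 * σ z.1 * σ z.2) (μ.prod μ)) :
    Integrable (fun t => (∫ x, h x t * σ x ∂μ) ^ 2) τ ∧
      ∫ z, k z.1 z.2 * σ z.1 * σ z.2 ∂(μ.prod μ) = ∫ t, (∫ x, h x t * σ x ∂μ) ^ 2 ∂τ := by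
  set F : (X × X) × T → ℝ := fun p => (h p.1.1 p.2 * h p.1.2 p.2) * (σ p.1.1 * σ p.1.2) with hF
  have hFm : AEStronglyMeasurable F ((μ.prod μ).prod τ) := by
    refine AEStronglyMeasurable.mul (Measurable.aestronglyMeasurable ?_) ?_
    · exact (hm.comp (by fun_prop : Measurable fun p : (X × X) × T => (p.1.1, p.2))).mul
        (hm.comp (by fun_prop : Measurable fun p : (X × X) × T => (p.1.2, p.2)))
    · exact (hσ.comp_fst.mul hσ.comp_snd).comp_fst
  -- Since h is nonnegative, integrating |F| in t returns |k σ σ|, which is integrable by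
  -- hypothesis; Fubini then applies on X × X × T.
  have hFi : Integrable F ((μ.prod μ).prod τ) := by
    rw [integrable_prod_iff hFm]
    refine ⟨hk.mono fun z hz => hz.1.mul_const (σ z.1 * σ z.2), hi.norm.congr (hk.mono fun z hz => ?_)⟩
    simp only [hF, norm_mul, Real.norm_of_nonneg (h0 _ _)]
    rw [integral_mul_const, hz.2, Real.norm_of_nonneg, mul_assoc]
    rw [← hz.2]
    exact integral_nonneg fun t => mul_nonneg (h0 _ _) (h0 _ _)
  have hsq : ∀ t, ∫ z, F (z, t) ∂(μ.prod μ) = (∫ x, h x t * σ x ∂μ) ^ 2 := by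
    intro t
    rw [sq, ← integral_prod_mul]
    exact integral_congr_ae (.of_forall fun z => by simp only [hF]; ring)
  constructor
  · exact hFi.integral_prod_right.congr (.of_forall hsq)
  · simp_rw [← hsq]
    rw [← integral_prod_symm _ hFi, integral_prod _ hFi]
    refine integral_congr_ae (hk.mono fun z hz => ?_)
    simp only [hF]
    rw [integral_mul_const, hz.2, mul_assoc]

end FeatureMap

/-! ### Newtonian kernel as a superposition of ball overlaps -/

/-- The volume of the intersection of two balls of the same radius. -/
noncomputable def lensVolume {N : ℕ} (r : ℝ) (x y : Space N) : ℝ :=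
  (volume : Measure (Space N)).real (Metric.closedBall x r ∩ Metric.closedBall y r)

lemma lensVolume_measure_ne_top {N : ℕ} (r : ℝ) (x y : Space N) :
    (volume : Measure (Space N)) (Metric.closedBall x r ∩ Metric.closedBall y r) ≠ ∞ :=
  ((measure_mono Set.inter_subset_left).trans_lt measure_closedBall_lt_top).ne

lemma lensVolume_monotone {N : ℕ} (x y : Space N) : Monotone fun r => lensVolume r x y :=
  fun _ _ h => measureReal_mono (Set.inter_subset_inter (Metric.closedBall_subset_closedBall h)
    (Metric.closedBall_subset_closedBall h)) (lensVolume_measure_ne_top _ _ _)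

lemma lensVolume_sub {N : ℕ} (r : ℝ) (x y : Space N) :
    lensVolume r x y = lensVolume r 0 (y - x) := by
  simp only [lensVolume, Measure.real]
  rw [← measure_preimage_add_right volume x]
  congr 2
  ext z
  simp [dist_eq_norm, sub_sub_eq_add_sub]

lemma lensVolume_congr {N : ℕ} (r : ℝ) {u v : Space N} (h : ‖u‖ = ‖v‖) :
    lensVolume r 0 u = lensVolume r 0 v := by
  obtain ⟨T, rfl⟩ := exists_linearIsometryEquiv_eq h
  simp only [lensVolume, Measure.real]
  rw [← T.measurePreserving.measure_preimage (s := Metric.closedBall 0 r ∩ Metric.closedBall (T u) r)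
    (Metric.isClosed_closedBall.inter Metric.isClosed_closedBall).measurableSet.nullMeasurableSet]
  congr 2
  ext z
  simp

lemma lensVolume_smul {N : ℕ} {d : ℝ} (hd : 0 < d) (r : ℝ) (u : Space N) :
    lensVolume (d * r) 0 (d • u) = d ^ N * lensVolume r 0 u := by
  have key := Measure.addHaar_preimage_smul (volume : Measure (Space N)) hd.ne'
    (Metric.closedBall 0 (d * r) ∩ Metric.closedBall (d • u) (d * r))
  have e : (d • · : Space N → Space N) ⁻¹'
      (Metric.closedBall 0 (d * r) ∩ Metric.closedBall (d • u) (d * r))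
      = Metric.closedBall 0 r ∩ Metric.closedBall u r := by
    ext z
    simp [← smul_sub, dist_eq_norm, norm_smul, abs_of_pos hd, hd]
  rw [e] at key
  simp only [lensVolume, Measure.real, key]
  rw [ENNReal.toReal_mul, ENNReal.toReal_ofReal (abs_nonneg _), abs_of_pos]
  · simp only [finrank_euclideanSpace, Fintype.card_fin]
    rw [← mul_assoc, mul_inv_cancel₀ (by positivity), one_mul]
  · simp only [finrank_euclideanSpace, Fintype.card_fin]; positivity

lemma lensVolume_eq_zero {N : ℕ} {r : ℝ} {x y : Space N} (h : 2 * r < dist x y) :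
    lensVolume r x y = 0 := by
  have : Metric.closedBall x r ∩ Metric.closedBall y r = ∅ := by
    ext z
    simp only [Set.mem_inter_iff, Metric.mem_closedBall, Set.mem_empty_iff_false, iff_false, not_and,
      not_le]
    intro h1
    have := dist_triangle_left x y z
    linarith
  simp [lensVolume, this]

lemma lensVolume_le {N : ℕ} {r : ℝ} (hr : 0 ≤ r) (x y : Space N) :
    lensVolume r x y ≤ r ^ N * unitBallVolume N := by
  refine (measureReal_mono Set.inter_subset_left measure_closedBall_lt_top.ne).trans_eq ?_
  simp [Measure.real, unitBallVolume, Measure.addHaar_closedBall volume x hr,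
    ENNReal.toReal_mul, ENNReal.toReal_ofReal (pow_nonneg hr N)]

lemma lensVolume_nonneg {N : ℕ} (r : ℝ) (x y : Space N) : 0 ≤ lensVolume r x y :=
  measureReal_nonneg

lemma lensVolume_pos {N : ℕ} {r : ℝ} {x y : Space N} (h : dist x y < r) :
    0 < lensVolume r x y := by
  have : 0 < (volume : Measure (Space N)) (Metric.closedBall x r ∩ Metric.closedBall y r) := by
    refine (Metric.measure_ball_pos volume x (sub_pos.2 h)).trans_le (measure_mono ?_)
    intro z hz
    rw [Metric.mem_ball] at hz
    simp only [Set.mem_inter_iff, Metric.mem_closedBall]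
    constructor
    · linarith [dist_nonneg (x := x) (y := y)]
    · linarith [dist_triangle z x y]
  exact ENNReal.toReal_pos this.ne' (lensVolume_measure_ne_top _ _ _)

/-- The balls are disjoint for small r, which kills the singularity at 0; for large r the bound r^N
on the overlap, up to a constant, leaves r^{1-N}, integrable as N > 2. -/
lemma integrableOn_rpow_mul_lensVolume {N : ℕ} (hN : 2 < N) {x y : Space N} (h : x ≠ y) :
    IntegrableOn (fun r : ℝ => r ^ (1 - 2 * (N : ℝ)) * lensVolume r x y) (Set.Ioi 0) := by
  have hN' : (2 : ℝ) < N := by exact_mod_cast hN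
  have hd : 0 < dist x y := dist_pos.2 h
  -- Any positive cut-off below half the distance would do.
  have h1 : IntegrableOn (fun r : ℝ => r ^ (1 - (N : ℝ))) (Set.Ioi (dist x y / 4)) :=
    integrableOn_Ioi_rpow_of_lt (by linarith) (by positivity)
  have h2 := ((integrable_indicator_iff measurableSet_Ioi).2 h1).mul_const (unitBallVolume N)
  refine h2.integrableOn.mono' ?_ ((ae_restrict_mem measurableSet_Ioi).mono fun r hr => ?_)
  · exact ((by fun_prop : Measurable fun r : ℝ => r ^ (1 - 2 * (N : ℝ))).mul
      (lensVolume_monotone x y).measurable).aestronglyMeasurable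
  · have hr0 : (0 : ℝ) < r := hr
    rw [Real.norm_of_nonneg (mul_nonneg (by positivity) (lensVolume_nonneg _ _ _))]
    by_cases hc : dist x y / 4 < r
    · rw [Set.indicator_of_mem (Set.mem_Ioi.2 hc)]
      have : r ^ (1 - (N : ℝ)) = r ^ (1 - 2 * (N : ℝ)) * r ^ N := by
        rw [← Real.rpow_natCast, ← Real.rpow_add hr0]; ring_nf
      rw [this, mul_assoc]
      gcongr
      exact lensVolume_le hr0.le x y
    · rw [lensVolume_eq_zero (by linarith)]
      rw [Set.indicator_of_notMem (show r ∉ Set.Ioi (dist x y / 4) from hc)]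
      simp

/-- The constant `A` in `∫₀^∞ r^{1-2N} |B(x,r) ∩ B(y,r)| dr = A |x-y|^{2-N}`. -/
noncomputable def lensConstant (N : ℕ) (e : Space N) : ℝ :=
  ∫ r in Set.Ioi (0 : ℝ), r ^ (1 - 2 * (N : ℝ)) * lensVolume r 0 e

lemma lensConstant_pos {N : ℕ} (hN : 2 < N) {e : Space N} (he : ‖e‖ = 1) :
    0 < lensConstant N e := by
  have hne : (0 : Space N) ≠ e := by rintro rfl; simp at he
  refine (setIntegral_pos_iff_support_of_nonneg_ae ((ae_restrict_mem measurableSet_Ioi).mono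
    fun r hr => ?_) (integrableOn_rpow_mul_lensVolume hN hne)).2 ?_
  · exact mul_nonneg (Real.rpow_nonneg (le_of_lt hr) _) (lensVolume_nonneg _ _ _)
  · refine (by simp : (0 : ℝ≥0∞) < volume (Set.Ioi (1 : ℝ))).trans_le (measure_mono fun r hr => ?_)
    have hr1 : (1 : ℝ) < r := hr
    have hr0 : (0 : ℝ) < r := by linarith
    exact ⟨(mul_pos (Real.rpow_pos_of_pos hr0 _)
      (lensVolume_pos (by simpa [dist_eq_norm, he] using hr1))).ne', hr0⟩

/-- The overlap depends only on r and d = |x-y|. Rescaling r by d gives the exponent 1 + (1-2N) + N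
= 2-N. -/
lemma integral_rpow_mul_lensVolume {N : ℕ} {e : Space N} (he : ‖e‖ = 1)
    {x y : Space N} (h : x ≠ y) :
    ∫ r in Set.Ioi (0 : ℝ), r ^ (1 - 2 * (N : ℝ)) * lensVolume r x y
      = lensConstant N e * newton N (x - y) := by
  set d := ‖x - y‖ with hd
  have hd0 : 0 < d := norm_pos_iff.2 (sub_ne_zero.2 h)
  have h1 : ∀ r, lensVolume r x y = lensVolume r 0 (d • e) := fun r => by
    rw [lensVolume_sub]
    exact lensVolume_congr r (by rw [norm_smul, he, hd, norm_norm, norm_sub_rev, mul_one])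
  simp_rw [h1]
  have h2 := integral_comp_mul_left_Ioi
    (fun r : ℝ => r ^ (1 - 2 * (N : ℝ)) * lensVolume r 0 (d • e)) 0 hd0
  rw [mul_zero, smul_eq_mul] at h2
  have h3 : ∫ r in Set.Ioi (0 : ℝ), (d * r) ^ (1 - 2 * (N : ℝ)) * lensVolume (d * r) 0 (d • e)
      = d ^ (1 - 2 * (N : ℝ)) * d ^ N * lensConstant N e := by
    rw [lensConstant, ← integral_const_mul]
    refine setIntegral_congr_fun measurableSet_Ioi fun r hr => ?_
    rw [lensVolume_smul hd0, Real.mul_rpow hd0.le (le_of_lt hr)]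
    ring
  rw [h3, eq_inv_mul_iff_mul_eq₀ hd0.ne'] at h2
  rw [← h2, newton, ← hd]
  have : d ^ (2 - (N : ℝ)) = d * (d ^ (1 - 2 * (N : ℝ)) * d ^ N) := by
    nth_rewrite 2 [← Real.rpow_one d]
    rw [← Real.rpow_natCast, ← Real.rpow_add hd0, ← Real.rpow_add hd0]; ring_nf
  rw [this]; ring

/-- The feature `r^{1/2-N} 1_{B(z,r)}(x)` of the Newtonian kernel. -/
noncomputable def ballFeature (N : ℕ) (x : Space N) (t : ℝ × Space N) : ℝ :=
  {p : Space N × (ℝ × Space N) | dist p.2.2 p.1 ≤ p.2.1 ∧ 0 < p.2.1}.indicator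
    (fun p => p.2.1 ^ (1 / 2 - (N : ℝ))) (x, t)

lemma measurable_ballFeature {N : ℕ} : Measurable (Function.uncurry (ballFeature N)) := by
  have h1 : Measurable fun p : Space N × (ℝ × Space N) => p.2.1 ^ (1 / 2 - (N : ℝ)) := by fun_prop
  have h2 : Measurable fun p : Space N × (ℝ × Space N) => dist p.2.2 p.1 := by fun_prop
  have h3 : Measurable fun p : Space N × (ℝ × Space N) => p.2.1 := by fun_prop
  exact h1.indicator ((measurableSet_le h2 h3).inter (measurableSet_lt measurable_const h3))

lemma ballFeature_nonneg {N : ℕ} (x : Space N) (t : ℝ × Space N) : 0 ≤ ballFeature N x t :=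
  Set.indicator_nonneg (fun _ hp => Real.rpow_nonneg hp.2.le _) _

lemma ballFeature_apply {N : ℕ} (x : Space N) {r : ℝ} (hr : 0 < r) (z : Space N) :
    ballFeature N x (r, z)
      = r ^ (1 / 2 - (N : ℝ)) * (Metric.closedBall z r).indicator (fun _ => 1) x := by
  simp only [ballFeature, Set.indicator, Set.mem_ofPred_eq, hr, and_true, Metric.mem_closedBall,
    dist_comm z x]
  split_ifs <;> simp

lemma ballFeature_mul {N : ℕ} (x y : Space N) {r : ℝ} (hr : 0 < r) (z : Space N) :
    ballFeature N x (r, z) * ballFeature N y (r, z) =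
      (Metric.closedBall x r ∩ Metric.closedBall y r).indicator
        (fun _ => r ^ (1 - 2 * (N : ℝ))) z := by
  rw [ballFeature_apply x hr, ballFeature_apply y hr]
  have : r ^ (1 - 2 * (N : ℝ)) = r ^ (1 / 2 - (N : ℝ)) * r ^ (1 / 2 - (N : ℝ)) := by
    rw [← Real.rpow_add hr]; ring_nf
  rw [this]
  by_cases h1 : dist z x ≤ r <;> by_cases h2 : dist z y ≤ r <;>
    simp [h1, h2, dist_comm x z, dist_comm y z, Set.indicator]

/-- The measure on the parameter space `(0,∞) × ℝ^N` of radii and centres. -/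
noncomputable abbrev ballMeasure (N : ℕ) : Measure (ℝ × Space N) :=
  (volume.restrict (Set.Ioi (0 : ℝ))).prod volume

lemma integral_ballFeature_mul_section {N : ℕ} (x y : Space N) {r : ℝ} (hr : 0 < r) :
    Integrable (fun z => ballFeature N x (r, z) * ballFeature N y (r, z)) ∧
      ∫ z, ballFeature N x (r, z) * ballFeature N y (r, z)
        = r ^ (1 - 2 * (N : ℝ)) * lensVolume r x y := by
  have hms : MeasurableSet (Metric.closedBall x r ∩ Metric.closedBall y r) :=
    (Metric.isClosed_closedBall.inter Metric.isClosed_closedBall).measurableSet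
  simp_rw [ballFeature_mul x y hr]
  constructor
  · exact (integrable_indicator_iff hms).2
      (integrableOn_const (lensVolume_measure_ne_top r x y))
  · rw [integral_indicator hms, setIntegral_const, smul_eq_mul, mul_comm, lensVolume]

lemma integrable_ballFeature_mul {N : ℕ} (hN : 2 < N) {x y : Space N} (h : x ≠ y) :
    Integrable (fun t => ballFeature N x t * ballFeature N y t) (ballMeasure N) := by
  have hx : ∀ x : Space N, Measurable fun t => ballFeature N x t := fun x =>
    Measurable.comp (g := Function.uncurry (ballFeature N)) (f := fun t => (x, t))
      measurable_ballFeature measurable_prodMk_left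
  have hm : Measurable fun t => ballFeature N x t * ballFeature N y t := (hx x).mul (hx y)
  refine (integrable_prod_iff hm.aestronglyMeasurable).2 ⟨?_, ?_⟩
  · exact (ae_restrict_mem measurableSet_Ioi).mono fun r hr =>
      (integral_ballFeature_mul_section x y hr).1
  · refine (integrableOn_rpow_mul_lensVolume hN h).congr
      ((ae_restrict_mem measurableSet_Ioi).mono fun r hr => ?_)
    simp only [Real.norm_of_nonneg (mul_nonneg (ballFeature_nonneg x _) (ballFeature_nonneg y _))]
    exact (integral_ballFeature_mul_section x y hr).2.symm

lemma integral_ballFeature_mul {N : ℕ} (hN : 2 < N) {e : Space N} (he : ‖e‖ = 1)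
    {x y : Space N} (h : x ≠ y) :
    ∫ t, ballFeature N x t * ballFeature N y t ∂ballMeasure N
      = lensConstant N e * newton N (x - y) := by
  rw [integral_prod _ (integrable_ballFeature_mul hN h), ← integral_rpow_mul_lensVolume he h]
  exact setIntegral_congr_fun measurableSet_Ioi
    fun r hr => (integral_ballFeature_mul_section x y hr).2

/-- The overlap representation is only available for x ≠ y, so the diagonal must be negligible. -/
lemma ae_prod_ne {N : ℕ} (hN : 0 < N) :
    ∀ᵐ z ∂(volume : Measure (Space N)).prod volume, z.1 ≠ z.2 := by
  have : Nonempty (Fin N) := ⟨⟨0, hN⟩⟩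
  have hm : MeasurableSet {z : Space N × Space N | z.1 ≠ z.2} :=
    (isOpen_ne_fun continuous_fst continuous_snd).measurableSet
  rw [Measure.ae_prod_iff_ae_ae hm]
  refine .of_forall fun x => ?_
  simp [ae_iff]

/-- An integrable function with vanishing integrals on almost every ball vanishes. -/
lemma ae_eq_zero_of_setIntegral_closedBall {N : ℕ} {σ : Space N → ℝ} (hσ : Integrable σ)
    (h : ∀ᵐ r ∂(volume.restrict (Set.Ioi (0 : ℝ))), ∀ᵐ z, ∫ x in Metric.closedBall z r, σ x = 0) :
    σ =ᵐ[volume] 0 := by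
  have hr : ∀ n : ℕ, ∃ r : ℝ, 0 < r ∧ r < 1 / (n + 1) ∧
      ∀ᵐ z, ∫ x in Metric.closedBall z r, σ x = 0 := by
    intro n
    have hn : (0 : ℝ) < 1 / (n + 1) := by positivity
    have h' : ∀ᵐ r ∂(volume.restrict (Set.Ioo (0 : ℝ) (1 / (n + 1)))),
        ∀ᵐ z, ∫ x in Metric.closedBall z r, σ x = 0 :=
      ae_mono (Measure.restrict_mono Set.Ioo_subset_Ioi_self le_rfl) h
    have : (ae (volume.restrict (Set.Ioo (0 : ℝ) (1 / (n + 1))))).NeBot := by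
      rw [ae_neBot, Ne, Measure.restrict_eq_zero, Real.volume_Ioo, sub_zero]
      simpa using hn
    obtain ⟨r, hr1, hr2⟩ := (h'.and (ae_restrict_mem measurableSet_Ioo)).exists
    exact ⟨r, hr2.1, hr2.2, hr1⟩
  choose r hr0 hr1 hr2 using hr
  have hlim : Filter.Tendsto r Filter.atTop (nhdsWithin 0 (Set.Ioi 0)) :=
    tendsto_nhdsWithin_iff.2 ⟨squeeze_zero (fun n => (hr0 n).le) (fun n => (hr1 n).le)
      tendsto_one_div_add_atTop_nhds_zero_nat, .of_forall hr0⟩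
  -- Lebesgue differentiation along radii tending to 0: σ(z) is the limit of averages that all
  -- vanish.
  filter_upwards [IsUnifLocDoublingMeasure.ae_tendsto_average volume hσ.locallyIntegrable 1,
    ae_all_iff.2 hr2] with z hz1 hz2
  have := hz1 (fun _ => z) r hlim (.of_forall fun n => by simpa using (hr0 n).le)
  have h0 : (fun n => ⨍ y in Metric.closedBall z (r n), σ y) = fun _ => 0 := by
    funext n
    rw [setAverage_eq, hz2 n, smul_zero]
  rw [h0] at this
  exact tendsto_nhds_unique this tendsto_const_nhds

/-- The Newtonian kernel is strictly positive definite. -/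
lemma newton_posDef {N : ℕ} (hN : 2 < N) {σ : Space N → ℝ} (hσ : Integrable σ) {C : ℝ}
    (hC : ∀ᵐ x, ‖σ x‖ ≤ C) :
    0 ≤ ∫ z : Space N × Space N, newton N (z.1 - z.2) * σ z.1 * σ z.2 ∂(volume.prod volume) ∧
    (∫ z : Space N × Space N, newton N (z.1 - z.2) * σ z.1 * σ z.2 ∂(volume.prod volume) = 0 →
      σ =ᵐ[volume] 0) := by
  have : Nonempty (Fin N) := ⟨⟨0, by omega⟩⟩
  obtain ⟨e, he⟩ := exists_norm_eq (Space N) zero_le_one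
  have hA := lensConstant_pos hN he
  set A := lensConstant N e with hAdef
  have hi : Integrable (fun z : Space N × Space N => A * newton N (z.1 - z.2) * σ z.1 * σ z.2)
      (volume.prod volume) :=
    ((integrable_newton_sub_mul_mul hN hσ hC hσ).const_mul A).congr
      (.of_forall fun z => by ring)
  obtain ⟨h1, h2⟩ := integral_featureMap (τ := ballMeasure N) measurable_ballFeature
    ballFeature_nonneg (k := fun x y => A * newton N (x - y))
    ((ae_prod_ne (by omega)).mono fun z hz =>
      ⟨integrable_ballFeature_mul hN hz, integral_ballFeature_mul hN he hz⟩)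
    hσ.aestronglyMeasurable hi
  have h3 : ∫ z : Space N × Space N, A * newton N (z.1 - z.2) * σ z.1 * σ z.2 ∂(volume.prod volume)
      = A * ∫ z : Space N × Space N, newton N (z.1 - z.2) * σ z.1 * σ z.2 ∂(volume.prod volume) := by
    rw [← integral_const_mul]
    exact integral_congr_ae (.of_forall fun z => by ring)
  rw [h3] at h2
  constructor
  · have : 0 ≤ A * ∫ z : Space N × Space N, newton N (z.1 - z.2) * σ z.1 * σ z.2
        ∂(volume.prod volume) := h2 ▸ integral_nonneg fun t => sq_nonneg _
    exact nonneg_of_mul_nonneg_right this hA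
  · intro h
    rw [h, mul_zero] at h2
    -- An integral of squares vanishes only if almost every feature integral does, that is, if σ has
    -- zero integral over almost every ball.
    have h4 := (integral_eq_zero_iff_of_nonneg (fun t => sq_nonneg _) h1).1 h2.symm
    refine ae_eq_zero_of_setIntegral_closedBall hσ ?_
    filter_upwards [Measure.ae_ae_of_ae_prod h4, ae_restrict_mem measurableSet_Ioi] with r hr hr0
    have hr0 : 0 < r := hr0
    filter_upwards [hr] with z hz
    have hz : (∫ x, ballFeature N x (r, z) * σ x) ^ 2 = 0 := hz
    have e2 : ∫ x, ballFeature N x (r, z) * σ x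
        = r ^ (1 / 2 - (N : ℝ)) * ∫ x in Metric.closedBall z r, σ x := by
      rw [← integral_indicator Metric.isClosed_closedBall.measurableSet, ← integral_const_mul]
      refine integral_congr_ae (.of_forall fun x => ?_)
      simp only [ballFeature_apply x hr0, Set.indicator]
      split_ifs <;> simp
    rw [e2, sq_eq_zero_iff, mul_eq_zero] at hz
    exact hz.resolve_left (Real.rpow_pos_of_pos hr0 _).ne'

end ExogenousEnergy

lemma MeasureTheory.Integrable.fun_sub {α : Type*} [MeasurableSpace α] {μ : Measure α}
    {f g : α → ℝ} (hf : Integrable f μ) (hg : Integrable g μ) :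
    Integrable (fun x => f x - g x) μ :=
  hf.sub hg

/-! ### Coulomb form and moments of densities -/

namespace ExogenousEnergy

/-- The Coulomb form `∬ |x-y|^{2-N} f(x) g(y) dx dy`. -/
noncomputable def coulomb (N : ℕ) (f g : Space N → ℝ) : ℝ :=
  ∫ z : Space N × Space N, newton N (z.1 - z.2) * f z.1 * g z.2 ∂(volume.prod volume)

lemma coulomb_comm {N : ℕ} (f g : Space N → ℝ) : coulomb N f g = coulomb N g f := by
  rw [coulomb, coulomb, ← integral_prod_swap]
  refine integral_congr_ae (.of_forall fun z => ?_)
  simp only [Prod.fst_swap, Prod.snd_swap, newton_sub_comm z.2 z.1]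
  ring

lemma coulomb_add_right {N : ℕ} (f : Space N → ℝ) (c : Space N) :
    coulomb N (fun x => f (x + c)) (fun x => f (x + c)) = coulomb N f f := by
  have h := ((measurePreserving_add_right (volume : Measure (Space N)) c).prod
    (measurePreserving_add_right (volume : Measure (Space N)) c)).integral_comp
    ((MeasurableEquiv.addRight c).prodCongr (MeasurableEquiv.addRight c)).measurableEmbedding
    (fun z => newton N (z.1 - z.2) * f z.1 * f z.2)
  simpa [coulomb, Prod.map] using h

lemma coulomb_sub_sub {N : ℕ} (hN : 2 < N) {f g : Space N → ℝ} (hf : Integrable f) {C : ℝ}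
    (hC : ∀ᵐ x, ‖f x‖ ≤ C) (hg : Integrable g) {C' : ℝ} (hC' : ∀ᵐ x, ‖g x‖ ≤ C') :
    coulomb N (fun x => f x - g x) (fun x => f x - g x)
      = coulomb N f f - 2 * coulomb N f g + coulomb N g g := by
  have hff := integrable_newton_sub_mul_mul hN hf hC hf
  have hfg := integrable_newton_sub_mul_mul hN hf hC hg
  have hgf := integrable_newton_sub_mul_mul hN hg hC' hf
  have hgg := integrable_newton_sub_mul_mul hN hg hC' hg
  have : coulomb N (fun x => f x - g x) (fun x => f x - g x)
      = coulomb N f f - coulomb N f g - coulomb N g f + coulomb N g g := by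
    simp only [coulomb]
    rw [← integral_sub hff hfg, ← integral_sub (hff.fun_sub hfg) hgf,
      ← integral_add ((hff.fun_sub hfg).fun_sub hgf) hgg]
    exact integral_congr_ae (.of_forall fun z => by ring)
  rw [this, coulomb_comm g f]
  ring

/-- A bounded nonnegative density of mass `m` with finite second moment. -/
structure IsDensity (N : ℕ) (M m : ℝ) (f : Space N → ℝ) : Prop where
  integrable : Integrable f
  norm_le : ∀ᵐ x, ‖f x‖ ≤ M
  nonneg : ∀ᵐ x, 0 ≤ f x
  integral_eq : ∫ x, f x = m
  integrable_norm_sq : Integrable fun x => ‖x‖ ^ 2 * f x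

namespace IsDensity

variable {N : ℕ} {M m : ℝ} {f : Space N → ℝ}

lemma integrable_smul (hf : IsDensity N M m f) : Integrable fun x => f x • x := by
  refine (hf.integrable.norm.add hf.integrable_norm_sq.norm).mono'
    (hf.integrable.aestronglyMeasurable.smul aestronglyMeasurable_id) (.of_forall fun x => ?_)
  simp only [Pi.add_apply, norm_smul, norm_mul, norm_pow, norm_norm]
  have : ‖x‖ ≤ 1 + ‖x‖ ^ 2 := by nlinarith [sq_nonneg (‖x‖ - 1)]
  nlinarith [norm_nonneg (f x)]

lemma integrable_inner (hf : IsDensity N M m f) (c : Space N) :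
    Integrable fun x => inner ℝ c x * f x :=
  (hf.integrable_smul.const_inner c).congr (.of_forall fun x => by
    simp only [inner_smul_right]; ring)

lemma integral_inner (hf : IsDensity N M m f) (c : Space N) :
    ∫ x, inner ℝ c x * f x = inner ℝ c (∫ x, f x • x) := by
  rw [← _root_.integral_inner hf.integrable_smul c]
  exact integral_congr_ae (.of_forall fun x => by simp only [inner_smul_right]; ring)

lemma norm_sub_sq_mul (c x : Space N) (t : ℝ) : ‖x - c‖ ^ 2 * t
    = ‖x‖ ^ 2 * t - 2 * (inner ℝ c x * t) + ‖c‖ ^ 2 * t := by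
  rw [norm_sub_sq_real, real_inner_comm]; ring

lemma integrable_norm_sub_sq (hf : IsDensity N M m f) (c : Space N) :
    Integrable fun x => ‖x - c‖ ^ 2 * f x := by
  simp_rw [norm_sub_sq_mul]
  exact (hf.integrable_norm_sq.sub ((hf.integrable_inner c).const_mul 2)).add
    (hf.integrable.const_mul _)

lemma integral_norm_sub_sq (hf : IsDensity N M m f) (c : Space N) :
    ∫ x, ‖x - c‖ ^ 2 * f x
      = (∫ x, ‖x‖ ^ 2 * f x) - 2 * inner ℝ c (∫ x, f x • x) + ‖c‖ ^ 2 * m := by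
  simp_rw [norm_sub_sq_mul]
  have h1 := hf.integrable_norm_sq
  have h2 := (hf.integrable_inner c).const_mul 2
  have h3 := hf.integrable.const_mul (‖c‖ ^ 2)
  rw [integral_add (h1.fun_sub h2) h3, integral_sub h1 h2, integral_const_mul, integral_const_mul,
    hf.integral_inner, hf.integral_eq]

lemma translate (hf : IsDensity N M m f) (c : Space N) : IsDensity N M m fun x => f (x + c) where
  integrable := hf.integrable.comp_add_right c
  norm_le := (measurePreserving_add_right volume c).quasiMeasurePreserving.ae hf.norm_le
  nonneg := (measurePreserving_add_right volume c).quasiMeasurePreserving.ae hf.nonneg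
  integral_eq := (integral_add_right_eq_self f c).trans hf.integral_eq
  integrable_norm_sq := by
    simpa using (hf.integrable_norm_sub_sq c).comp_add_right c

lemma integral_norm_sq_translate (hf : IsDensity N M m f) (c : Space N) :
    ∫ x, ‖x‖ ^ 2 * f (x + c) = (∫ x, ‖x‖ ^ 2 * f x) - 2 * inner ℝ c (∫ x, f x • x) + ‖c‖ ^ 2 * m := by
  rw [← hf.integral_norm_sub_sq c,
    ← integral_add_right_eq_self (fun x => ‖x - c‖ ^ 2 * f x) c]
  simp

lemma integrable_norm_sub_sq_mul_mul (hf : IsDensity N M m f) :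
    Integrable (fun z : Space N × Space N => ‖z.1 - z.2‖ ^ 2 * f z.1 * f z.2)
      (volume.prod volume) := by
  have h1 := hf.integrable_norm_sq.norm.mul_prod hf.integrable.norm
  have h2 := hf.integrable.norm.mul_prod hf.integrable_norm_sq.norm
  refine ((h1.add h2).const_mul 2).mono' ?_ (.of_forall fun z => ?_)
  · exact ((by fun_prop : Continuous fun z : Space N × Space N =>
      ‖z.1 - z.2‖ ^ 2).aestronglyMeasurable.mul
      hf.integrable.aestronglyMeasurable.comp_fst).mul hf.integrable.aestronglyMeasurable.comp_snd
  · simp only [Pi.add_apply, norm_mul, norm_pow, norm_norm]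
    have h : ‖z.1 - z.2‖ ^ 2 ≤ 2 * (‖z.1‖ ^ 2 + ‖z.2‖ ^ 2) := by
      have := norm_sub_le z.1 z.2
      nlinarith [sq_nonneg (‖z.1‖ - ‖z.2‖), norm_nonneg (z.1 - z.2)]
    calc ‖z.1 - z.2‖ ^ 2 * ‖f z.1‖ * ‖f z.2‖
        ≤ 2 * (‖z.1‖ ^ 2 + ‖z.2‖ ^ 2) * ‖f z.1‖ * ‖f z.2‖ := by gcongr
      _ = _ := by ring

/-- Expanding the square, the cross term factors through the first moment. -/
lemma integral_norm_sub_sq_mul_mul (hf : IsDensity N M m f) :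
    ∫ z : Space N × Space N, ‖z.1 - z.2‖ ^ 2 * f z.1 * f z.2 ∂(volume.prod volume)
      = 2 * m * (∫ x, ‖x‖ ^ 2 * f x) - 2 * ‖∫ x, f x • x‖ ^ 2 := by
  rw [integral_prod_symm _ hf.integrable_norm_sub_sq_mul_mul]
  simp_rw [integral_mul_const, hf.integral_norm_sub_sq]
  set b := ∫ x, f x • x
  set S := ∫ x, ‖x‖ ^ 2 * f x
  have e : ∀ y, (S - 2 * inner ℝ y b + ‖y‖ ^ 2 * m) * f y
      = S * f y - 2 * (inner ℝ b y * f y) + m * (‖y‖ ^ 2 * f y) := by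
    intro y; rw [real_inner_comm]; ring
  simp_rw [e]
  have h1 := hf.integrable.const_mul S
  have h2 := (hf.integrable_inner b).const_mul 2
  have h3 := hf.integrable_norm_sq.const_mul m
  rw [integral_add (h1.fun_sub h2) h3, integral_sub h1 h2, integral_const_mul, integral_const_mul,
    integral_const_mul, hf.integral_eq, hf.integral_inner, real_inner_self_eq_norm_sq]
  ring

end IsDensity

/-! ### Energy relative to the centre of mass -/

lemma kernel_eq {N : ℕ} (hN : 2 < N) (x : Space N) :
    kernel N 2 (2 - (N : ℝ)) x = 1 / 2 * ‖x‖ ^ 2 + 1 / ((N : ℝ) - 2) * newton N x := by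
  have hN' : (2 : ℝ) < N := by exact_mod_cast hN
  have h : 1 / (2 - (N : ℝ)) = - (1 / ((N : ℝ) - 2)) := by
    rw [← neg_sub, one_div_neg_eq_neg_one_div]
  rw [kernel, Real.rpow_two, newton, h]
  ring

section Energy

variable {N : ℕ} {M m : ℝ} {f : Space N → ℝ}

lemma kernel_mul_mul (hN : 2 < N) (z : Space N × Space N) :
    kernel N 2 (2 - (N : ℝ)) (z.1 - z.2) * f z.1 * f z.2
      = 1 / 2 * (‖z.1 - z.2‖ ^ 2 * f z.1 * f z.2)
        + 1 / ((N : ℝ) - 2) * (newton N (z.1 - z.2) * f z.1 * f z.2) := by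
  rw [kernel_eq hN]; ring

lemma IsDensity.energyFinite (hN : 2 < N) (β : ℝ) (hf : IsDensity N M m f) :
    EnergyFinite N (kernel N 2 (2 - (N : ℝ))) (quadraticPotential N β) f := by
  constructor
  · simp_rw [kernel_mul_mul hN]
    exact (hf.integrable_norm_sub_sq_mul_mul.const_mul _).add
      ((integrable_newton_sub_mul_mul hN hf.integrable hf.norm_le hf.integrable).const_mul _)
  · simp_rw [quadraticPotential, mul_assoc]
    exact hf.integrable_norm_sq.const_mul β

/-- The energy relative to the centre of mass: a confining term and the Coulomb energy. -/
noncomputable def confinedEnergy (N : ℕ) (β m : ℝ) (f : Space N → ℝ) : ℝ :=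
  (m / 2 + β) * (∫ x, ‖x‖ ^ 2 * f x) + 1 / (2 * ((N : ℝ) - 2)) * coulomb N f f

lemma IsDensity.energy_eq (hN : 2 < N) (β : ℝ) (hf : IsDensity N M m f) :
    energy N (kernel N 2 (2 - (N : ℝ))) (quadraticPotential N β) f
      = confinedEnergy N β m f - 1 / 2 * ‖∫ x, f x • x‖ ^ 2 := by
  have hN' : (N : ℝ) - 2 ≠ 0 := by
    have : (2 : ℝ) < N := by exact_mod_cast hN
    linarith
  have h1 := (hf.energyFinite hN β).1
  rw [energy, ← integral_prod_symm _ h1]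
  simp_rw [kernel_mul_mul hN, quadraticPotential, mul_assoc β]
  rw [integral_add (hf.integrable_norm_sub_sq_mul_mul.const_mul _)
      ((integrable_newton_sub_mul_mul hN hf.integrable hf.norm_le hf.integrable).const_mul _),
    integral_const_mul, integral_const_mul, integral_const_mul, hf.integral_norm_sub_sq_mul_mul,
    confinedEnergy, ← coulomb]
  field_simp
  ring

/-- The Coulomb part is translation invariant and centring lowers the second moment by m|c|². This
changes the confinement by (m/2+β)m|c|², of which (m²/2)|c|² cancels the barycentre term. -/
lemma IsDensity.energy_eq_translate (hN : 2 < N) (β : ℝ) (hm : 0 < m) (hf : IsDensity N M m f)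
    {c : Space N} (hc : ∫ x, f x • x = m • c) :
    energy N (kernel N 2 (2 - (N : ℝ))) (quadraticPotential N β) f
      = confinedEnergy N β m (fun x => f (x + c)) + β * m * ‖c‖ ^ 2 := by
  rw [hf.energy_eq hN, confinedEnergy, confinedEnergy, hf.integral_norm_sq_translate, hc,
    coulomb_add_right, inner_smul_right, real_inner_self_eq_norm_sq, norm_smul,
    Real.norm_of_nonneg hm.le]
  ring

end Energy

/-! ### The ball density: admissibility, Euler–Lagrange conditions and optimality -/

section Ball

variable {N : ℕ} {M β m : ℝ}

lemma radius_pos (hβ : 0 < β) (hm : 0 < m) : 0 < radius N β m := by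
  unfold radius; positivity

lemma radius_pow (hN : 2 < N) (hβ : 0 < β) (hm : 0 < m) :
    (m + 2 * β) * radius N β m ^ N = m := by
  rw [radius, one_div, Real.rpow_inv_natCast_pow (by positivity) (by omega)]
  field_simp

lemma continuous_weight : Continuous (weight N 2 (quadraticPotential N β)) := by
  have : weight N 2 (quadraticPotential N β)
      = fun x : Space N => max (β * ‖x‖ ^ 2) ((1 + ‖x‖) ^ 2) := by
    funext x
    simp [weight, quadraticPotential]
  rw [this]
  fun_prop

lemma ballDensity_mul (g : Space N → ℝ) :
    (fun x => g x * ballDensity N β m x) = (Metric.ball (0 : Space N) (radius N β m)).indicator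
      fun x => g x * ((m + 2 * β) / unitBallVolume N) := by
  funext x
  simp only [ballDensity, Set.indicator]
  split_ifs <;> simp

lemma integrable_mul_ballDensity {g : Space N → ℝ} (hg : Continuous g) :
    Integrable fun x => g x * ballDensity N β m x := by
  rw [ballDensity_mul, integrable_indicator_iff Metric.isOpen_ball.measurableSet]
  exact (integrableOn_ball_of_continuous hg _ _).mul_const _

lemma ballDensity_nonneg (hβ : 0 < β) (hm : 0 < m) (x : Space N) : 0 ≤ ballDensity N β m x :=
  Set.indicator_nonneg (fun _ _ => div_nonneg (by positivity) (unitBallVolume_pos N).le) x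

lemma integral_ballDensity (hN : 2 < N) (hβ : 0 < β) (hm : 0 < m) :
    ∫ x, ballDensity N β m x = m := by
  rw [ballDensity, integral_indicator Metric.isOpen_ball.measurableSet, setIntegral_const,
    volume_real_ball (radius_pos hβ hm), smul_eq_mul]
  have h := radius_pow hN hβ hm
  have := (unitBallVolume_pos N).ne'
  field_simp
  linarith

lemma integral_ballDensity_smul : ∫ x, ballDensity N β m x • x = 0 := by
  have h := integral_neg_eq_self (fun x => ballDensity N β m x • x) (volume : Measure (Space N))
  have e : ∀ x, ballDensity N β m (-x) • (-x) = -(ballDensity N β m x • x) := by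
    intro x
    simp [ballDensity, Set.indicator]
  simp_rw [e] at h
  rw [integral_neg] at h
  have h2 : (2 : ℝ) • ∫ x, ballDensity N β m x • x = 0 := by
    rw [two_smul]
    nth_rewrite 1 [← h]
    exact neg_add_cancel _
  exact (smul_eq_zero.1 h2).resolve_left two_ne_zero

lemma isDensity_ballDensity (hN : 2 < N) (hβ : 0 < β) (hm : 0 < m)
    (hM : (m + 2 * β) / unitBallVolume N ≤ M) : IsDensity N M m (ballDensity N β m) where
  integrable := integrable_indicator_ball _ _
  norm_le := .of_forall fun x => (norm_indicator_ball_le _ _ x).trans (by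
    rwa [abs_of_nonneg (div_nonneg (by positivity) (unitBallVolume_pos N).le)])
  nonneg := .of_forall (ballDensity_nonneg hβ hm)
  integral_eq := integral_ballDensity hN hβ hm
  integrable_norm_sq := integrable_mul_ballDensity (by fun_prop)

lemma IsDensity.eLpNorm_one {f : Space N → ℝ} (hf : IsDensity N M m f) :
    eLpNorm f 1 volume = ENNReal.ofReal m := by
  rw [eLpNorm_one_eq_lintegral_enorm, ← ofReal_integral_norm_eq_lintegral_enorm hf.integrable,
    ← hf.integral_eq]
  exact congrArg _ (integral_congr_ae (hf.nonneg.mono fun x hx => Real.norm_of_nonneg hx))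

lemma ballDensity_mem_admissible (hN : 2 < N) (hβ : 0 < β) (hm : 0 < m)
    (hM : (m + 2 * β) / unitBallVolume N ≤ M) :
    ballDensity N β m ∈ admissible N 2 (quadraticPotential N β) M m := by
  have hd := isDensity_ballDensity hN hβ hm hM
  exact ⟨memLp_one_iff_integrable.2 hd.integrable,
    memLp_top_of_bound hd.integrable.aestronglyMeasurable M hd.norm_le, hd.nonneg,
    eLpNorm_le_of_ae_bound hd.norm_le |>.trans (by simp), hd.eLpNorm_one,
    integrable_mul_ballDensity continuous_weight⟩

/-- The weight dominates (1+|x|)² ≥ |x|², so weighted integrability gives a finite second moment. -/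
lemma isDensity_of_mem_admissible (hm : 0 < m) (hM : 0 ≤ M) {ρ : Space N → ℝ}
    (h : ρ ∈ admissible N 2 (quadraticPotential N β) M m) : IsDensity N M m ρ := by
  obtain ⟨h1, -, h0, hM', hm', hW⟩ := h
  have hi := memLp_one_iff_integrable.1 h1
  refine ⟨hi, ?_, h0, ?_, ?_⟩
  · rw [eLpNorm_exponent_top] at hM'
    filter_upwards [enorm_ae_le_eLpNormEssSup ρ volume] with x hx
    have := hx.trans hM'
    rwa [← ofReal_norm, ENNReal.ofReal_le_ofReal_iff hM] at this
  · rw [eLpNorm_one_eq_lintegral_enorm, ← ofReal_integral_norm_eq_lintegral_enorm hi,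
      ENNReal.ofReal_eq_ofReal_iff (integral_nonneg fun _ => norm_nonneg _) hm.le] at hm'
    rw [← hm']
    exact integral_congr_ae (h0.mono fun x hx => (Real.norm_of_nonneg hx).symm)
  · refine hW.norm.mono' ((by fun_prop : Continuous fun x : Space N =>
      ‖x‖ ^ 2).aestronglyMeasurable.mul hi.aestronglyMeasurable) (.of_forall fun x => ?_)
    rw [norm_mul, norm_mul]
    gcongr
    rw [weight, if_pos two_pos, Real.rpow_two, Real.norm_of_nonneg (by positivity),
      Real.norm_of_nonneg (le_max_of_le_right (by positivity))]
    refine le_max_of_le_right ?_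
    gcongr
    linarith

/-- Weighted AM–GM for s² and r^N s^{2-N}: the weights (N-2)/N and 2/N make the powers of s cancel,
leaving r² as geometric mean. -/
lemma mul_sq_le_add_rpow (hN : 2 < N) {r s : ℝ} (hr : 0 < r) (hs : 0 < s) :
    N * r ^ 2 ≤ (N - 2) * s ^ 2 + 2 * (r ^ N * s ^ (2 - (N : ℝ))) := by
  have hN' : (2 : ℝ) < N := by exact_mod_cast hN
  have hN0 : (0 : ℝ) < N := by linarith
  have h := Real.geom_mean_le_arith_mean2_weighted (w₁ := (N - 2) / N) (w₂ := 2 / N)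
    (p₁ := s ^ 2) (p₂ := r ^ N * s ^ (2 - (N : ℝ))) (div_nonneg (by linarith) hN0.le)
    (by positivity) (by positivity) (by positivity) (by field_simp; ring)
  have e : (s ^ 2) ^ (((N : ℝ) - 2) / N) * (r ^ N * s ^ (2 - (N : ℝ))) ^ (2 / (N : ℝ)) = r ^ 2 := by
    rw [Real.mul_rpow (by positivity) (by positivity), ← Real.rpow_natCast, ← Real.rpow_natCast,
      ← Real.rpow_mul hs.le, ← Real.rpow_mul hr.le, ← Real.rpow_mul hs.le, mul_left_comm,
      ← Real.rpow_add hs, ← Real.rpow_natCast r 2]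
    have e1 : ((2 : ℕ) : ℝ) * (((N : ℝ) - 2) / N) + (2 - N) * (2 / N) = 0 := by
      push_cast; field_simp; ring
    have e2 : (N : ℝ) * (2 / N) = (2 : ℕ) := by push_cast; field_simp
    rw [e1, e2, Real.rpow_zero, mul_one]
  rw [e] at h
  have : N * r ^ 2 ≤ N * (((N : ℝ) - 2) / N * s ^ 2 + 2 / N * (r ^ N * s ^ (2 - (N : ℝ)))) := by
    gcongr
  refine this.trans_eq ?_
  field_simp

/-- The total potential `(m/2+β)|x|² + (N-2)^{-1} |·|^{2-N} * ρ₀` generated by the ball density. -/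
noncomputable def totalPotential (N : ℕ) (β m : ℝ) (x : Space N) : ℝ :=
  (m / 2 + β) * ‖x‖ ^ 2 + 1 / ((N : ℝ) - 2) *
    ((m + 2 * β) / unitBallVolume N * ballPotential N (radius N β m) x)

/-- The value of the total potential on the ball. -/
noncomputable def potentialLevel (N : ℕ) (β m : ℝ) : ℝ :=
  (m / 2 + β) * (N / (N - 2)) * radius N β m ^ 2

/-- The height (m+2β)/ω_N is exactly the one for which the -|x|² part of the ball's potential
cancels the confinement. -/
lemma totalPotential_of_norm_lt (hN : 2 < N) {x : Space N} (hx : ‖x‖ < radius N β m) :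
    totalPotential N β m x = potentialLevel N β m := by
  have hN' : (N : ℝ) - 2 ≠ 0 := by
    have : (2 : ℝ) < N := by exact_mod_cast hN
    linarith
  have := (unitBallVolume_pos N).ne'
  rw [totalPotential, potentialLevel, ballPotential_of_norm_lt hN hx]
  field_simp
  ring

/-- By Newton's theorem the exterior potential is a combination of |x|² and |x|^{2-N}, and the AM–GM
bound, multiplied by (m/2+β)/(N-2), is the claim. -/
lemma potentialLevel_le (hN : 2 < N) (hβ : 0 < β) (hm : 0 < m) {x : Space N}
    (hx : radius N β m < ‖x‖) : potentialLevel N β m ≤ totalPotential N β m x := by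
  have hN' : 0 < (N : ℝ) - 2 := by
    have : (2 : ℝ) < N := by exact_mod_cast hN
    linarith
  have hω := (unitBallVolume_pos N).ne'
  have hr := radius_pos (N := N) hβ hm
  have h := mul_sq_le_add_rpow hN hr (hr.trans hx)
  rw [totalPotential, potentialLevel, ballPotential_of_lt_norm hN hr hx, newton]
  set r := radius N β m
  have h2 : (m / 2 + β) / (N - 2) * (N * r ^ 2)
      ≤ (m / 2 + β) / (N - 2) * ((N - 2) * ‖x‖ ^ 2 + 2 * (r ^ N * ‖x‖ ^ (2 - (N : ℝ)))) :=
    mul_le_mul_of_nonneg_left h (by positivity)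
  convert h2 using 1
  · ring
  · field_simp

/-- Second-order expansion of a quadratic functional, exact with no remainder; the first variation
at the ball density is the total potential. -/
lemma confinedEnergy_sub (hN : 2 < N) {f : Space N → ℝ} (hf : IsDensity N M m f)
    (hρ : IsDensity N M m (ballDensity N β m)) :
    Integrable (fun x => totalPotential N β m x * (f x - ballDensity N β m x)) ∧
    confinedEnergy N β m f - confinedEnergy N β m (ballDensity N β m)
      = (∫ x, totalPotential N β m x * (f x - ballDensity N β m x))
        + 1 / (2 * ((N : ℝ) - 2)) * coulomb N (fun x => f x - ballDensity N β m x)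
          (fun x => f x - ballDensity N β m x) := by
  have hN' : (N : ℝ) - 2 ≠ 0 := by
    have : (2 : ℝ) < N := by exact_mod_cast hN
    linarith
  set D := (m + 2 * β) / unitBallVolume N
  set r := radius N β m
  set ρ := ballDensity N β m with hρdef
  have hc : ∀ g : Space N → ℝ, Integrable g → (∀ᵐ x, ‖g x‖ ≤ M) →
      coulomb N g ρ = D * ∫ x, ballPotential N r x * g x := by
    intro g hg hgM
    rw [integral_ballPotential_mul hN r hg hgM, ← integral_const_mul, coulomb]
    refine integral_congr_ae (.of_forall fun z => ?_)
    simp only [hρdef, ballDensity, Set.indicator]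
    split_ifs <;> simp [D, mul_comm]
  have i1 := (hf.integrable_norm_sq.fun_sub hρ.integrable_norm_sq).const_mul (m / 2 + β)
  have i2 := ((integrable_ballPotential_mul hN r hf.integrable hf.norm_le).fun_sub
    (integrable_ballPotential_mul hN r hρ.integrable hρ.norm_le)).const_mul (1 / ((N : ℝ) - 2) * D)
  have e : ∀ x, totalPotential N β m x * (f x - ρ x)
      = (m / 2 + β) * (‖x‖ ^ 2 * f x - ‖x‖ ^ 2 * ρ x)
        + 1 / ((N : ℝ) - 2) * D * (ballPotential N r x * f x - ballPotential N r x * ρ x) := by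
    intro x; rw [totalPotential]; ring
  simp_rw [e]
  refine ⟨i1.add i2, ?_⟩
  rw [integral_add i1 i2, integral_const_mul, integral_const_mul,
    integral_sub hf.integrable_norm_sq hρ.integrable_norm_sq,
    integral_sub (integrable_ballPotential_mul hN r hf.integrable hf.norm_le)
      (integrable_ballPotential_mul hN r hρ.integrable hρ.norm_le),
    coulomb_sub_sub hN hf.integrable hf.norm_le hρ.integrable hρ.norm_le, confinedEnergy,
    confinedEnergy, hc f hf.integrable hf.norm_le, hc ρ hρ.integrable hρ.norm_le]
  field_simp
  ring

lemma confinedEnergy_ballDensity_le (hN : 2 < N) (hβ : 0 < β) (hm : 0 < m) {f : Space N → ℝ}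
    (hf : IsDensity N M m f) (hρ : IsDensity N M m (ballDensity N β m)) :
    confinedEnergy N β m (ballDensity N β m) ≤ confinedEnergy N β m f ∧
      (confinedEnergy N β m f ≤ confinedEnergy N β m (ballDensity N β m) →
        f =ᵐ[volume] ballDensity N β m) := by
  have : Nonempty (Fin N) := ⟨⟨0, by omega⟩⟩
  obtain ⟨hi, heq⟩ := confinedEnergy_sub hN hf hρ
  have hκ : 0 < 1 / (2 * ((N : ℝ) - 2)) := by
    have : (2 : ℝ) < N := by exact_mod_cast hN
    have : 0 < (N : ℝ) - 2 := by linarith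
    positivity
  have hσ := hf.integrable.fun_sub hρ.integrable
  have hσC : ∀ᵐ x, ‖f x - ballDensity N β m x‖ ≤ M + M := by
    filter_upwards [hf.norm_le, hρ.norm_le] with x h1 h2
    exact (norm_sub_le _ _).trans (add_le_add h1 h2)
  obtain ⟨hpos, hzero⟩ := newton_posDef hN hσ hσC
  have hlin : 0 ≤ ∫ x, totalPotential N β m x * (f x - ballDensity N β m x) := by
    -- Both densities have mass m, so a constant multiple of their difference integrates to 0 and
    -- the potential can be compared with its level on the ball.
    have h0 : ∫ x, potentialLevel N β m * (f x - ballDensity N β m x) = 0 := by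
      rw [integral_const_mul, integral_sub hf.integrable hρ.integrable, hf.integral_eq,
        hρ.integral_eq, sub_self, mul_zero]
    rw [← h0]
    refine integral_mono_ae (hσ.const_mul _) hi ?_
    -- The potential was computed only off the boundary sphere, which is null.
    have hsph : ∀ᵐ x : Space N, x ∉ Metric.sphere (0 : Space N) (radius N β m) :=
      measure_eq_zero_iff_ae_notMem.1 (Measure.addHaar_sphere volume 0 _)
    filter_upwards [hf.nonneg, hsph] with x hx hxs
    rw [mem_sphere_zero_iff_norm] at hxs
    rcases lt_or_gt_of_ne hxs with hlt | hgt
    · rw [totalPotential_of_norm_lt hN hlt]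
    · have h1 := potentialLevel_le hN hβ hm hgt
      have h2 : ballDensity N β m x = 0 :=
        Set.indicator_of_notMem (by simpa using hgt.le) _
      rw [h2, sub_zero]
      exact mul_le_mul_of_nonneg_right h1 hx
  have hpos' : 0 ≤ coulomb N (fun x => f x - ballDensity N β m x)
      (fun x => f x - ballDensity N β m x) := hpos
  have hmul := mul_nonneg hκ.le hpos'
  refine ⟨by linarith, fun hle => ?_⟩
  have hJ : coulomb N (fun x => f x - ballDensity N β m x)
      (fun x => f x - ballDensity N β m x) = 0 :=
    (mul_eq_zero.1 (by linarith : 1 / (2 * ((N : ℝ) - 2)) * _ = 0)).resolve_left hκ.ne'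
  filter_upwards [hzero hJ] with x hx
  exact sub_eq_zero.1 hx

end Ball

end ExogenousEnergy

theorem theorem1p3 (N : ℕ) (hN : 2 < N) (β : ℝ) (hβ : 0 < β) (m : ℝ) (hm : 0 < m)
    (M : ℝ) (hM : (m + 2 * β) / ExogenousEnergy.unitBallVolume N ≤ M)
    (K : ExogenousEnergy.Space N → ℝ) (hK : K = ExogenousEnergy.kernel N 2 (2 - (N : ℝ)))
    (F : ExogenousEnergy.Space N → ℝ) (hF : F = ExogenousEnergy.quadraticPotential N β)
    (D : Set (ExogenousEnergy.Space N → ℝ)) (hD : D = ExogenousEnergy.admissible N 2 F M m)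
    (ρ₀ : ExogenousEnergy.Space N → ℝ) (hρ₀ : ρ₀ = ExogenousEnergy.ballDensity N β m) :
    (∀ ρ ∈ D, ExogenousEnergy.EnergyFinite N K F ρ) ∧
      ρ₀ ∈ D ∧
      IsMinOn (ExogenousEnergy.energy N K F) D ρ₀ ∧
      ∀ ρ ∈ D, IsMinOn (ExogenousEnergy.energy N K F) D ρ →
        ρ =ᵐ[MeasureTheory.volume] ρ₀ := by
  subst hK hF hD hρ₀
  have hM0 : 0 ≤ M :=
    (div_nonneg (by positivity) (ExogenousEnergy.unitBallVolume_pos N).le).trans hM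
  have hρ := ExogenousEnergy.isDensity_ballDensity hN hβ hm hM
  have hmem := ExogenousEnergy.ballDensity_mem_admissible hN hβ hm hM
  have hE₀ := hρ.energy_eq hN β
  rw [ExogenousEnergy.integral_ballDensity_smul, norm_zero] at hE₀
  have hdens : ∀ ρ ∈ ExogenousEnergy.admissible N 2 (ExogenousEnergy.quadraticPotential N β) M m,
      ExogenousEnergy.IsDensity N M m ρ := fun ρ h =>
    ExogenousEnergy.isDensity_of_mem_admissible hm hM0 h
  have hE : ∀ ρ, ExogenousEnergy.IsDensity N M m ρ → ∃ c : ExogenousEnergy.Space N,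
      ExogenousEnergy.energy N (ExogenousEnergy.kernel N 2 (2 - (N : ℝ)))
        (ExogenousEnergy.quadraticPotential N β) ρ
      = ExogenousEnergy.confinedEnergy N β m (fun x => ρ (x + c)) + β * m * ‖c‖ ^ 2 := fun ρ h =>
    -- The witness is the centre of mass of ρ.
    ⟨m⁻¹ • ∫ x, ρ x • x, h.energy_eq_translate hN β hm (by rw [smul_inv_smul₀ hm.ne'])⟩
  refine ⟨fun ρ h => (hdens ρ h).energyFinite hN β, hmem, ?_, ?_⟩
  · rw [isMinOn_iff]
    intro ρ h
    obtain ⟨c, hc⟩ := hE ρ (hdens ρ h)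
    have h1 := (ExogenousEnergy.confinedEnergy_ballDensity_le hN hβ hm
      ((hdens ρ h).translate c) hρ).1
    have h2 : 0 ≤ β * m * ‖c‖ ^ 2 := by positivity
    rw [hc, hE₀]
    linarith
  · intro ρ h hmin
    obtain ⟨c, hc⟩ := hE ρ (hdens ρ h)
    have h0 := isMinOn_iff.1 hmin _ hmem
    obtain ⟨h1, h2⟩ := ExogenousEnergy.confinedEnergy_ballDensity_le hN hβ hm
      ((hdens ρ h).translate c) hρ
    have h3 : 0 ≤ β * m * ‖c‖ ^ 2 := by positivity
    rw [hc, hE₀] at h0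
    -- Minimality makes G[ρ(·+c)] + βm|c|² at most G[ρ₀], which is at most G[ρ(·+c)]. As β and m are
    -- positive, c = 0, so no translate of ρ₀ is another minimizer.
    have hc0 : c = 0 := by
      have : β * m * ‖c‖ ^ 2 = 0 := by linarith
      simpa [hβ.ne', hm.ne'] using this
    have h4 := h2 (by linarith)
    simpa [hc0] using h4
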